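/- Let $f:\mathbb{R}^n\to\mathbb{R}^n$ and let $x^*$ be an equilibrium, $f(x^*)=0$. Assume that near $x^*$ the field $f$ is piecewise continuously differentiable (some open neighbourhood $U$ of $x^*$ is covered by finitely many closed sets, and on the part of each of them in $U$ the field $f$ coincides with a function that is $C^1$ on $U$), that $f$ is differentiable at $x^*$ with Jacobian matrix $A=Df(x^*)$, and that $x^*$ is hyperbolic: no eigenvalue of $A$ has zero real part. (In particular $x^*$ may be any unstable hyperbolic equilibrium: saddle, focus or saddle-focus, with any number of positive real eigenvalues.) A *real Jordan decomposition* of $A$ consists of an invertible $V$ and integers $m,p\ge 0$ with $m+2p=n$ such that $A=V^{-1}DV$, $D=\mathrm{diag}(\lambda_1,\dots,\lambda_m,B_1,\dots,B_p)+N$, where $\lambda_i\in\mathbb{R}$, $B_i=\begin{bmatrix}\mu_i&-\omega_i\\ \omega_i&\mu_i\end{bmatrix}$ with $\omega_i\neq0$, and the off-diagonal part $N$ is zero except that two consecutive $1\times1$ blocks with the same eigenvalue may be coupled by a superdiagonal entry $1$, and two consecutive equal blocks $B_i=B_{i+1}$ may be coupled by the superdiagonal block $\begin{bmatrix}1&0\\0&1\end{bmatrix}$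 or $\begin{bmatrix}0&0\\1&0\end{bmatrix}$. Then $A$ has a real Jordan decomposition. Moreover, for every real Jordan decomposition of $A$, every $\tau>0$, all $\zeta_i$ with $|\zeta_i|<1$ ($1\le i\le m$) and all $\rho_i\in[0,1)$, $\theta_i\in[0,2\pi)$ ($1\le i\le p$), the following holds. Let $\widetilde K=\mathrm{diag}(k_1,\dots,k_m,E_1,\dots,E_p)$ (which does not depend on $N$), where $$k_i=\begin{cases}0,&\lambda_i<0,\\[2pt] \dfrac{e^{-\lambda_i\tau}(e^{3\lambda_i\tau}-\zeta_i)}{\tau(e^{\lambda_i\tau}-1)},&\lambda_i>0,\end{cases}\qquad E_i=\begin{cases}0_{2\times2},&\mu_i<0,\\[2pt] \begin{bmatrix}\epsilon_{i1}&-\epsilon_{i2}\\ \epsilon_{i2}&\epsilon_{i1}\end{bmatrix},&\mu_i>0,\end{cases}$$ and, dropping the index $i$ of $\mu,\omega,\rho,\theta$, $$\epsilon_{i1}=\frac{\rho\cos(\theta-\omega\tau)-\rho e^{\mu\tau}\cos(\theta-2\omega\tau)-e^{3\mu\tau}\cos(2\omega\tau)+e^{4\mu\tau}\cos(\omega\tau)}{\tau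 e^{\mu\tau}\left(1-2e^{\mu\tau}\cos(\omega\tau)+e^{2\mu\tau}\right)},$$ $$\epsilon_{i2}=\frac{\rho\sin(\theta-\omega\tau)-\rho e^{\mu\tau}\sin(\theta-2\omega\tau)-e^{3\mu\tau}\sin(2\omega\tau)+e^{4\mu\tau}\sin(\omega\tau)}{\tau e^{\mu\tau}\left(1-2e^{\mu\tau}\cos(\omega\tau)+e^{2\mu\tau}\right)}.$$ Put $K=V^{-1}\widetilde KV$, and for $k=0,1,2,\dots$ let $K(t)=0$ for $3k\tau\le t<(3k+2)\tau$ and $K(t)=K$ for $(3k+2)\tau\le t<(3k+3)\tau$. Then $x^*$ is a locally asymptotically stable equilibrium of the controlled delay equation $$\dot x(t)=f(x(t))+K(t)\big(x(t-2\tau)-x(t-\tau)\big)$$ (solutions are continuous and satisfy the equation with the right derivative). That is: for every $\varepsilon>0$ there is $\delta>0$ such that, for every $t_0\ge0$ and every continuous initial function $\varphi$ on $[t_0-2\tau,t_0]$ with $\|\varphi(s)-x^*\|<\delta$ for all $s$, every solution on an interval $[t_0,T)$ that starts from $\varphi$ satisfies $\|x(t)-x^*\|<\varepsilon$ on it; and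 there is $\delta>0$ such that, for every $t_0\ge 0$ and every such $\varphi$, a solution on $[t_0,\infty)$ exists and every solution on $[t_0,\infty)$ tends to $x^*$ as $t\to\infty$. -/

import Mathlib

open Set Filter Topology

noncomputable section

namespace TDFC

/-- `f` is piecewise continuously differentiable near `x`: on an open neighbourhood `U` of `x`,
covered by finitely many closed pieces, `f` coincides on each piece with a function that is
`C¹` on `U`. (A function that is `C¹` near `x` is the case of a single piece.) -/
def PiecewiseC1At {n : ℕ} (f : (Fin n → ℝ) → (Fin n → ℝ)) (x : Fin n → ℝ) : Prop :=
  ∃ U : Set (Fin n → ℝ), IsOpen U ∧ x ∈ U ∧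
    ∃ (k : ℕ) (C : Fin k → Set (Fin n → ℝ)) (g : Fin k → (Fin n → ℝ) → (Fin n → ℝ)),
      (∀ i, IsClosed (C i)) ∧ U ⊆ ⋃ i, C i ∧
      ∀ i, ContDiffOn ℝ 1 (g i) U ∧ EqOn f (g i) (U ∩ C i)

/-- `A` is the Jacobian matrix of `f` at `x` (and `f` is differentiable there). -/
def IsJacobianAt {n : ℕ} (f : (Fin n → ℝ) → (Fin n → ℝ)) (A : Matrix (Fin n) (Fin n) ℝ)
    (x : Fin n → ℝ) : Prop :=
  HasFDerivAt f (LinearMap.toContinuousLinearMap (Matrix.mulVecLin A)) x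

/-- No complex eigenvalue of the real matrix `A` lies on the imaginary axis. -/
def IsHyperbolic {n : ℕ} (A : Matrix (Fin n) (Fin n) ℝ) : Prop :=
  ∀ z ∈ spectrum ℂ (A.map (algebraMap ℝ ℂ)), z.re ≠ 0

/-! ### Real Jordan form -/

/-- Row and column labels: `m` one-dimensional blocks, then `p` two-dimensional ones. -/
abbrev BlockIndex (m p : ℕ) : Type := Fin m ⊕ (Fin p × Fin 2)

/-- The labels in their natural order: `i ↦ i` and `(i, a) ↦ m + 2 i + a`. -/
def blockEquiv {m p n : ℕ} (h : m + p * 2 = n) : BlockIndex m p ≃ Fin n :=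
  ((Equiv.sumCongr (Equiv.refl (Fin m)) finProdFinEquiv).trans finSumFinEquiv).trans (finCongr h)

/-- The matrix of multiplication by `a + i b` on `ℂ = ℝ²`. -/
def rotBlock (a b : ℝ) : Matrix (Fin 2) (Fin 2) ℝ := !![a, -b; b, a]

/-- The block-diagonal matrix with `1 × 1` blocks `d i` and `2 × 2` blocks `B i`. -/
def blockDiag {m p : ℕ} (d : Fin m → ℝ) (B : Fin p → Matrix (Fin 2) (Fin 2) ℝ) :
    Matrix (BlockIndex m p) (BlockIndex m p) ℝ :=
  Matrix.fromBlocks (Matrix.diagonal d) 0 0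
    (Matrix.of fun r s => if r.1 = s.1 then B r.1 r.2 s.2 else 0)

/-- `N` is the off-diagonal part of a real Jordan matrix with real eigenvalues `lam i` and
non-real eigenvalues `mu i ± i om i`. It couples only consecutive blocks of the same eigenvalue.
Real blocks are coupled by an entry `1`. Two-dimensional blocks are coupled either by the
`2 × 2` identity or by a single `1` on the superdiagonal of the whole matrix; both conventions
for the real Jordan form are in use and both are allowed. -/
def IsJordanOffDiag {m p : ℕ} (lam : Fin m → ℝ) (mu om : Fin p → ℝ)
    (N : Matrix (BlockIndex m p) (BlockIndex m p) ℝ) : Prop :=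
  (∀ i j : Fin m, N (Sum.inl i) (Sum.inl j) = 0 ∨
    ((i : ℕ) + 1 = j ∧ lam i = lam j ∧ N (Sum.inl i) (Sum.inl j) = 1)) ∧
  (∀ (i : Fin m) (r : Fin p × Fin 2), N (Sum.inl i) (Sum.inr r) = 0 ∧
    N (Sum.inr r) (Sum.inl i) = 0) ∧
  (∀ i j : Fin p,
    let S : Matrix (Fin 2) (Fin 2) ℝ := Matrix.of fun a b => N (Sum.inr (i, a)) (Sum.inr (j, b))
    S = 0 ∨ ((i : ℕ) + 1 = j ∧ mu i = mu j ∧ om i = om j ∧ (S = 1 ∨ S = !![0, 0; 1, 0])))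

/-- `A = V⁻¹ D V` with `V` invertible and `D` in real Jordan form, with real eigenvalues `lam i`,
pairs of non-real eigenvalues `mu i ± i om i`, and off-diagonal part `N`. -/
def IsRealJordanDecomposition {m p n : ℕ} (h : m + p * 2 = n) (A V : Matrix (Fin n) (Fin n) ℝ)
    (lam : Fin m → ℝ) (mu om : Fin p → ℝ)
    (N : Matrix (BlockIndex m p) (BlockIndex m p) ℝ) : Prop :=
  IsUnit V ∧ (∀ i, om i ≠ 0) ∧ IsJordanOffDiag lam mu om N ∧
  A = V⁻¹ * Matrix.reindex (blockEquiv h) (blockEquiv h)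
        (blockDiag lam (fun i => rotBlock (mu i) (om i)) + N) * V

/-! ### The gain matrix -/

/-- The gain for a real eigenvalue `lam > 0`. -/
def realGain (tau lam zeta : ℝ) : ℝ :=
  Real.exp (-lam * tau) * (Real.exp (3 * lam * tau) - zeta) /
    (tau * (Real.exp (lam * tau) - 1))

/-- Common denominator of the two gains for a pair `mu ± i om` with `mu > 0`. -/
def complexGainDenom (tau mu om : ℝ) : ℝ :=
  tau * Real.exp (mu * tau) *
    (1 - 2 * Real.exp (mu * tau) * Real.cos (om * tau) + Real.exp (2 * mu * tau))

/-- First gain for a pair `mu ± i om` with `mu > 0`. -/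
def complexGain₁ (tau mu om rho theta : ℝ) : ℝ :=
  (rho * Real.cos (theta - om * tau)
    - rho * Real.exp (mu * tau) * Real.cos (theta - 2 * om * tau)
    - Real.exp (3 * mu * tau) * Real.cos (2 * om * tau)
    + Real.exp (4 * mu * tau) * Real.cos (om * tau)) / complexGainDenom tau mu om

/-- Second gain for a pair `mu ± i om` with `mu > 0`. -/
def complexGain₂ (tau mu om rho theta : ℝ) : ℝ :=
  (rho * Real.sin (theta - om * tau)
    - rho * Real.exp (mu * tau) * Real.sin (theta - 2 * om * tau)
    - Real.exp (3 * mu * tau) * Real.sin (2 * om * tau)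
    + Real.exp (4 * mu * tau) * Real.sin (om * tau)) / complexGainDenom tau mu om

/-- The block-diagonal gain matrix in Jordan coordinates: the blocks of eigenvalues with positive
real part carry the gains above, the other blocks are zero. -/
def gainTilde {m p n : ℕ} (h : m + p * 2 = n) (tau : ℝ) (lam : Fin m → ℝ) (mu om : Fin p → ℝ)
    (zeta : Fin m → ℝ) (rho theta : Fin p → ℝ) : Matrix (Fin n) (Fin n) ℝ :=
  Matrix.reindex (blockEquiv h) (blockEquiv h)
    (blockDiag (fun i => if 0 < lam i then realGain tau (lam i) (zeta i) else 0)
      (fun i => if 0 < mu i then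
          rotBlock (complexGain₁ tau (mu i) (om i) (rho i) (theta i))
            (complexGain₂ tau (mu i) (om i) (rho i) (theta i))
        else 0))

open Classical in
/-- The `3 tau`-periodic on/off gain on `[0, ∞)`: `K` on `[(3k+2) tau, (3k+3) tau)` for `k ∈ ℕ`,
and zero on `[3k tau, (3k+2) tau)`. -/
def periodicGain {n : ℕ} (tau : ℝ) (K : Matrix (Fin n) (Fin n) ℝ) (t : ℝ) :
    Matrix (Fin n) (Fin n) ℝ :=
  if ∃ k : ℕ, (3 * (k : ℝ) + 2) * tau ≤ t ∧ t < (3 * (k : ℝ) + 3) * tau then K else 0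

/-! ### The controlled system -/

/-- `x` solves `x'(t) = f (x t) + K(t) (x (t - 2 tau) - x (t - tau))` for `t ∈ S`, where
`S = [t₀, T)` or `S = [t₀, ∞)`, with the initial function `φ` on `[t₀ - 2 tau, t₀]`. The gain is
right-continuous with jumps, so `x` is continuous and the equation holds with the right
derivative. -/
structure IsControlledSolution {n : ℕ} (f : (Fin n → ℝ) → (Fin n → ℝ)) (tau : ℝ)
    (K : Matrix (Fin n) (Fin n) ℝ) (t₀ : ℝ) (φ : ℝ → Fin n → ℝ) (S : Set ℝ)
    (x : ℝ → Fin n → ℝ) : Prop where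
  continuousOn : ContinuousOn x (Icc (t₀ - 2 * tau) t₀ ∪ S)
  initial : EqOn x φ (Icc (t₀ - 2 * tau) t₀)
  equation : ∀ t ∈ S, HasDerivWithinAt x
    (f (x t) + (periodicGain tau K t).mulVec (x (t - 2 * tau) - x (t - tau))) (Ici t) t

/-- `φ` is an initial function on `[t₀ - 2 tau, t₀]` within distance `δ` of `xs`. -/
def IsSmallHistory {n : ℕ} (tau t₀ : ℝ) (xs : Fin n → ℝ) (δ : ℝ) (φ : ℝ → Fin n → ℝ) : Prop :=
  ContinuousOn φ (Icc (t₀ - 2 * tau) t₀) ∧ ∀ s ∈ Icc (t₀ - 2 * tau) t₀, ‖φ s - xs‖ < δ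

/-- Local asymptotic stability of the equilibrium `xs` of the controlled system, as a delay
differential equation. First part: Lyapunov stability, for every solution on any interval
`[t₀, T)`. Second part: every initial function close to `xs` has a solution on `[t₀, ∞)`, and all
such solutions converge to `xs`. (On `Fin n → ℝ` the norm is the maximum norm; the notion does not
depend on the choice of a norm on `ℝⁿ`.) -/
def IsLocallyAsymptoticallyStable {n : ℕ} (f : (Fin n → ℝ) → (Fin n → ℝ)) (tau : ℝ)
    (K : Matrix (Fin n) (Fin n) ℝ) (xs : Fin n → ℝ) : Prop :=
  (∀ ε > 0, ∃ δ > 0, ∀ t₀ ≥ 0, ∀ φ, IsSmallHistory tau t₀ xs δ φ →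
    ∀ T > t₀, ∀ x, IsControlledSolution f tau K t₀ φ (Ico t₀ T) x →
      ∀ t ∈ Ico t₀ T, ‖x t - xs‖ < ε) ∧
  (∃ δ > 0, ∀ t₀ ≥ 0, ∀ φ, IsSmallHistory tau t₀ xs δ φ →
    (∃ x, IsControlledSolution f tau K t₀ φ (Ici t₀) x) ∧
    ∀ x, IsControlledSolution f tau K t₀ φ (Ici t₀) x → Tendsto x atTop (𝓝 xs))

end TDFC

end

/-!
Passing to complex Jordan coordinates with a geometric scaling along the Jordan chains makes the
coupling `N` as small as desired, so up to an arbitrarily small relative error the linearised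
system splits into scalar modes `u' = L u`, where `L` runs over the eigenvalues. With
`E = exp (L τ)` and a gain `k` on the mode, the solution over one control period `3 τ` is
multiplied by `E ^ 3 + τ k (E - E ^ 2)`, which depends only on the state at the start of the period
because the two delays never reach further back while the control is on. This multiplier has
modulus less than one without control if `Re L < 0`; if `Re L > 0`, the prescribed gains are exactly
those for which it equals `ζ` or `ρ exp (i θ)`. By a Gronwall estimate for delay equations the
contraction of the period map persists under the small coupling and the nonlinear remainder, which
gives exponential decay. Solutions are constructed by the method of steps for a globally Lipschitz
extension of `f`. The real Jordan form itself comes from the primary cyclic decomposition of `ℝⁿ` as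
a module over `ℝ[X]`.
-/

noncomputable section

namespace TDFC

/-! ### Piecewise `C¹` fields are locally Lipschitz -/

theorem norm_sub_le_of_lipschitzOnWith_closed_cover {F ι : Type*} [NormedAddCommGroup F]
    [Finite ι] {h : ℝ → F} {D : ι → Set ℝ} {a b : ℝ} {L : NNReal} (hab : a ≤ b)
    (hD : ∀ i, IsClosed (D i)) (hcov : Icc a b ⊆ ⋃ i, D i)
    (hL : ∀ i, LipschitzOnWith L h (Icc a b ∩ D i)) : ‖h b - h a‖ ≤ L * (b - a) := by
  have hcont : ContinuousOn h (Icc a b) := by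
    have hunion : ContinuousOn h (⋃ i, Icc a b ∩ D i) :=
      (locallyFinite_of_finite _).continuousOn_iUnion (fun i => isClosed_Icc.inter (hD i))
        fun i => (hL i).continuousOn
    rw [← inter_iUnion] at hunion
    exact hunion.mono (subset_inter subset_rfl hcov)
  -- A single piece contains points arbitrarily close to the right of `x`, hence also `x` itself.
  have hslope : ∀ x ∈ Ico a b, ∀ r, (L : ℝ) < r →
      ∃ᶠ z in 𝓝[>] x, slope (norm ∘ fun t => h t - h a) x z < r := by
    intro x hx r hr
    have hright : ∀ᶠ z in 𝓝[>] x, z ∈ Ioc x b := Ioc_mem_nhdsGT hx.2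
    obtain ⟨i, hi⟩ : ∃ i, ∃ᶠ z in 𝓝[>] x, z ∈ D i := frequently_exists.1
      (hright.mono fun z hz => mem_iUnion.1 (hcov ⟨hx.1.trans hz.1.le, hz.2⟩)).frequently
    have hxi : x ∈ D i := by
      rw [← (hD i).closure_eq, mem_closure_iff_frequently]
      exact hi.filter_mono nhdsWithin_le_nhds
    refine (hi.and_eventually hright).mono fun z hz => lt_of_le_of_lt ?_ hr
    have hzx : 0 < z - x := sub_pos.2 hz.2.1
    have hLip := (hL i).norm_sub_le ⟨⟨hx.1.trans hz.2.1.le, hz.2.2⟩, hz.1⟩ ⟨⟨hx.1, hx.2.le⟩, hxi⟩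
    rw [Real.norm_of_nonneg hzx.le] at hLip
    rw [slope_def_field, div_le_iff₀ hzx]
    calc ‖h z - h a‖ - ‖h x - h a‖ ≤ ‖h z - h a - (h x - h a)‖ := norm_sub_norm_le _ _
      _ = ‖h z - h x‖ := by rw [sub_sub_sub_cancel_right]
      _ ≤ L * (z - x) := hLip
  exact image_le_of_liminf_slope_right_le_deriv_boundary (B := fun t => L * (t - a))
    (B' := fun _ => L) (hcont.sub continuousOn_const).norm (by simp) (by fun_prop)
    (fun x _ => by
      simpa using (((hasDerivAt_id x).sub_const a).const_mul (L : ℝ)).hasDerivWithinAt) hslope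
    (right_mem_Icc.2 hab)

theorem lipschitzOnWith_of_closed_cover {E F ι : Type*} [NormedAddCommGroup E] [NormedSpace ℝ E]
    [NormedAddCommGroup F] [Finite ι] {f : E → F} {B : Set E} {C : ι → Set E} {L : NNReal}
    (hB : Convex ℝ B) (hC : ∀ i, IsClosed (C i)) (hcov : B ⊆ ⋃ i, C i)
    (hL : ∀ i, LipschitzOnWith L f (B ∩ C i)) : LipschitzOnWith L f B := by
  refine LipschitzOnWith.of_dist_le_mul fun x hx y hy => ?_
  let l : ℝ → E := AffineMap.lineMap y x
  have hlB : ∀ t ∈ Icc (0 : ℝ) 1, l t ∈ B := fun t ht => hB.lineMap_mem hy hx ht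
  have hl : LipschitzWith (nndist y x) l := lipschitzWith_lineMap y x
  have hmove := norm_sub_le_of_lipschitzOnWith_closed_cover (h := f ∘ l) (D := fun i => l ⁻¹' C i)
    (L := L * nndist y x) zero_le_one (fun i => (hC i).preimage hl.continuous)
    (fun t ht => by simpa using hcov (hlB t ht))
    (fun i => (hL i).comp hl.lipschitzOnWith fun t ht => And.imp_left (hlB t) ht)
  simpa [l, dist_eq_norm, norm_sub_rev y x] using hmove

theorem PiecewiseC1At.exists_lipschitzOnWith {n : ℕ} {f : (Fin n → ℝ) → (Fin n → ℝ)}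
    {x : Fin n → ℝ} (hf : PiecewiseC1At f x) :
    ∃ r > 0, ∃ L, LipschitzOnWith L f (Metric.closedBall x r) := by
  obtain ⟨U, hU, hxU, k, C, g, hC, hcov, hg⟩ := hf
  have hlocal : ∀ i, ∃ K, ∃ s ∈ 𝓝 x, LipschitzOnWith K (g i) s := fun i =>
    ((hg i).1.contDiffAt (hU.mem_nhds hxU)).exists_lipschitzOnWith
  choose K s hs hK using hlocal
  obtain ⟨r, hr, hball⟩ := Metric.nhds_basis_closedBall.mem_iff.1
    (inter_mem (hU.mem_nhds hxU) (iInter_mem.2 hs))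
  refine ⟨r, hr, Finset.univ.sup K, lipschitzOnWith_of_closed_cover (convex_closedBall x r) hC
    (fun _ hy => hcov (hball hy).1) fun i => ?_⟩
  have hgi : LipschitzOnWith (Finset.univ.sup K) (g i) (Metric.closedBall x r ∩ C i) :=
    ((hK i).mono fun y hy => mem_iInter.1 (hball hy.1).2 i).weaken
      (Finset.le_sup (Finset.mem_univ i))
  have hfg : EqOn f (g i) (Metric.closedBall x r ∩ C i) :=
    (hg i).2.mono (inter_subset_inter_left _ fun _ hy => (hball hy).1)
  intro y hy z hz
  rw [hfg hy, hfg hz]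
  exact hgi hy hz

/-! ### A Gronwall inequality for delay equations -/

theorem gronwallBound_le_gronwallBound {δ c ε x y : ℝ} (hδ : 0 ≤ δ) (hc : 0 ≤ c) (hε : 0 ≤ ε)
    (hxy : x ≤ y) : gronwallBound δ c ε x ≤ gronwallBound δ c ε y := by
  unfold gronwallBound
  split_ifs <;> gcongr

theorem gronwallBound_eq_add_mul (δ c ε x : ℝ) :
    gronwallBound δ c ε x = δ * Real.exp (c * x) + ε * gronwallBound 0 c 1 x := by
  unfold gronwallBound
  split_ifs with h
  · simp [h]
  · ring

section DelayGronwall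

variable {E : Type*} [NormedAddCommGroup E] [NormedSpace ℝ E] {z z' : ℝ → E} {a T c δ ε : ℝ}

theorem norm_le_gronwallBound_of_delay_of_pos (hδ : 0 < δ) (hc : 0 ≤ c) (hε : 0 ≤ ε)
    (hz : ContinuousOn z (Icc a T)) (hd : ∀ t ∈ Ico a T, HasDerivWithinAt z (z' t) (Ici t) t)
    (ha : ‖z a‖ ≤ δ)
    (hz' : ∀ t ∈ Ico a T, ∀ W, δ ≤ W → (∀ s ∈ Icc a t, ‖z s‖ ≤ W) → ‖z' t‖ ≤ c * W + ε)
    {t : ℝ} (ht : t ∈ Icc a T) : ‖z t‖ ≤ gronwallBound δ c ε (t - a) := by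
  set B : ℝ → ℝ := fun s => gronwallBound δ c ε (s - a) with hBdef
  have hBmono : ∀ {s u}, s ≤ u → B s ≤ B u := fun h =>
    gronwallBound_le_gronwallBound hδ.le hc hε (sub_le_sub_right h a)
  have hBa : B a = δ := by simp [hBdef, gronwallBound_x0]
  have hBd : ∀ s, HasDerivAt B (c * B s + ε) s := fun s => hasDerivAt_gronwallBound_shift δ c ε s a
  have hBpos : ∀ s ∈ Icc a T, 0 < B s := fun s hs => hδ.trans_le (hBa ▸ hBmono hs.1)
  obtain ⟨s, hs, hmax⟩ := isCompact_Icc.exists_isMaxOn ⟨t, ht⟩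
    (hz.norm.div (HasDerivAt.continuousOn fun s _ => hBd s) fun s hs => (hBpos s hs).ne')
  set M : ℝ := ‖z s‖ / B s
  have hzM : ∀ u ∈ Icc a T, ‖z u‖ ≤ M * B u := fun u hu => (div_le_iff₀ (hBpos u hu)).1 (hmax hu)
  -- If `M > 1`, then `δ + M (B - δ)` still dominates `z`, but it is smaller than `M B` at `s`.
  suffices hM1 : M ≤ 1 from
    (hzM t ht).trans (mul_le_of_le_one_left (hBpos t ht).le hM1)
  by_contra! hM1
  have hzs : ‖z s‖ ≤ δ + M * (B s - δ) :=
    image_norm_le_of_norm_deriv_right_le_deriv_boundary (a := a) (b := s)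
      (hz.mono (Icc_subset_Icc_right hs.2)) (fun u hu => hd u ⟨hu.1, hu.2.trans_le hs.2⟩)
      (B := fun u => δ + M * (B u - δ)) (B' := fun u => M * (c * B u + ε)) (by simpa [hBa] using ha)
      (fun u => (((hBd u).sub_const δ).const_mul M).const_add δ)
      (fun u hu => by
        have hδu : δ ≤ B u := hBa ▸ hBmono hu.1
        have hpast := hz' u ⟨hu.1, hu.2.trans_le hs.2⟩ (M * B u) (by nlinarith) fun v hv =>
          (hzM v ⟨hv.1, hv.2.trans (hu.2.le.trans hs.2)⟩).trans
            (mul_le_mul_of_nonneg_left (hBmono hv.2) (by linarith))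
        nlinarith)
      (right_mem_Icc.2 hs.1)
  have : ‖z s‖ = M * B s := (div_mul_cancel₀ _ (hBpos s hs).ne').symm
  nlinarith

theorem norm_le_gronwallBound_of_delay (hc : 0 ≤ c) (hε : 0 ≤ ε)
    (hz : ContinuousOn z (Icc a T)) (hd : ∀ t ∈ Ico a T, HasDerivWithinAt z (z' t) (Ici t) t)
    (ha : ‖z a‖ ≤ δ)
    (hz' : ∀ t ∈ Ico a T, ∀ W, δ ≤ W → (∀ s ∈ Icc a t, ‖z s‖ ≤ W) → ‖z' t‖ ≤ c * W + ε)
    {t : ℝ} (ht : t ∈ Icc a T) : ‖z t‖ ≤ gronwallBound δ c ε (t - a) := by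
  have hδ : 0 ≤ δ := (norm_nonneg _).trans ha
  have hlim : Tendsto (fun d => gronwallBound d c ε (t - a)) (𝓝[>] δ)
      (𝓝 (gronwallBound δ c ε (t - a))) := by
    simp only [gronwallBound_eq_add_mul _ c ε]
    exact (Continuous.tendsto (by fun_prop) δ).mono_left nhdsWithin_le_nhds
  refine ge_of_tendsto hlim (eventually_mem_nhdsWithin.mono fun d hd' => ?_)
  exact norm_le_gronwallBound_of_delay_of_pos (hδ.trans_lt hd') hc hε hz hd (ha.trans hd'.le)
    (fun s hs W hW => hz' s hs W (hd'.le.trans hW)) ht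

end DelayGronwall

/-! ### Decoupled modes over one control period -/

open Classical in
/-- The on/off switch of the control: `periodicGain tau K t` is `gainSwitch tau t • K`. -/
def gainSwitch (tau t : ℝ) : ℝ :=
  if ∃ k : ℕ, (3 * (k : ℝ) + 2) * tau ≤ t ∧ t < (3 * (k : ℝ) + 3) * tau then 1 else 0

theorem periodicGain_eq_smul {n : ℕ} (tau : ℝ) (K : Matrix (Fin n) (Fin n) ℝ) (t : ℝ) :
    periodicGain tau K t = gainSwitch tau t • K := by
  unfold periodicGain gainSwitch
  split_ifs <;> simp

theorem norm_gainSwitch_le_one (tau t : ℝ) : ‖gainSwitch tau t‖ ≤ 1 := by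
  unfold gainSwitch; split_ifs <;> simp

theorem gainSwitch_add {tau s : ℝ} (htau : 0 < tau) (k : ℕ) (hs₀ : 0 ≤ s) (hs : s < 3 * tau) :
    gainSwitch tau (3 * k * tau + s) = if 2 * tau ≤ s then 1 else 0 := by
  suffices hon : (∃ j : ℕ, (3 * (j : ℝ) + 2) * tau ≤ 3 * k * tau + s ∧
      3 * k * tau + s < (3 * (j : ℝ) + 3) * tau) ↔ 2 * tau ≤ s by simp only [gainSwitch, hon]
  refine ⟨?_, fun h => ⟨k, by linarith, by linarith⟩⟩
  rintro ⟨j, hj₁, hj₂⟩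
  have hlt : (3 * (j : ℝ) + 2) < 3 * k + 3 := by
    refine lt_of_mul_lt_mul_right ?_ htau.le; linarith
  have hgt : 3 * (k : ℝ) < 3 * j + 3 := by
    refine lt_of_mul_lt_mul_right ?_ htau.le; linarith
  obtain rfl : j = k := by norm_cast at hlt hgt; omega
  linarith

theorem le_sub_of_gainSwitch_ne_zero {tau t : ℝ} (htau : 0 < tau) {k : ℕ}
    (ht : t ∈ Ico (3 * k * tau) (3 * k * tau + 3 * tau)) (hon : gainSwitch tau t ≠ 0) :
    3 * k * tau ≤ t - 2 * tau := by
  have hswitch := gainSwitch_add htau k (sub_nonneg.2 ht.1) (by linarith [ht.2])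
  rw [add_sub_cancel] at hswitch
  rw [hswitch, ne_eq, ite_eq_right_iff, Classical.not_imp] at hon
  linarith [hon.1]

/-- The fundamental solution on `[0, 3 tau]` of the scalar mode `u' = L u`, to which the feedback
`k (u (t - 2 tau) - u (t - tau))` is added from time `2 tau` on. -/
def modeFlow (tau : ℝ) (L k : ℂ) (t : ℝ) : ℂ :=
  Complex.exp (L * t) + ((max (t - 2 * tau) 0 : ℝ) : ℂ) *
    (k * (Complex.exp (L * (t - 2 * tau : ℝ)) - Complex.exp (L * (t - tau : ℝ))))

/-- The multiplier of the controlled scalar mode `L` with gain `k` over one period. -/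
def modeMultiplier (tau : ℝ) (L k : ℂ) : ℂ := modeFlow tau L k (3 * tau)

section ModeFlow

variable {tau : ℝ} {L k : ℂ} {t : ℝ}

theorem modeFlow_of_le (ht : t ≤ 2 * tau) : modeFlow tau L k t = Complex.exp (L * t) := by
  simp [modeFlow, max_eq_right (sub_nonpos.2 ht)]

theorem continuous_modeFlow : Continuous (modeFlow tau L k) := by
  unfold modeFlow; fun_prop

theorem hasDerivAt_exp_mul_sub (L : ℂ) (b t : ℝ) :
    HasDerivAt (fun s : ℝ => Complex.exp (L * (s - b : ℝ)))
      (L * Complex.exp (L * (t - b : ℝ))) t := by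
  have hlin : HasDerivAt (fun s : ℝ => L * ((s - b : ℝ) : ℂ)) L t := by
    simpa using ((hasDerivAt_id t).sub_const b).ofReal_comp.const_mul L
  simpa [mul_comm] using hlin.cexp

theorem hasDerivWithinAt_modeFlow (htau : 0 < tau) (ht : t < 3 * tau) :
    HasDerivWithinAt (modeFlow tau L k) (L * modeFlow tau L k t +
      (if 2 * tau ≤ t then 1 else 0 : ℝ) •
        (k * (modeFlow tau L k (t - 2 * tau) - modeFlow tau L k (t - tau)))) (Ici t) t := by
  have hexp : HasDerivAt (fun s : ℝ => Complex.exp (L * s)) (L * Complex.exp (L * t)) t := by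
    simpa using hasDerivAt_exp_mul_sub L 0 t
  split_ifs with h
  · rw [modeFlow_of_le (t := t - 2 * tau) (by linarith),
      modeFlow_of_le (t := t - tau) (by linarith)]
    have hramp : HasDerivAt (fun s : ℝ => ((s - 2 * tau : ℝ) : ℂ)) 1 t := by
      simpa using ((hasDerivAt_id t).sub_const (2 * tau)).ofReal_comp
    have hctrl := hexp.add (hramp.mul (((hasDerivAt_exp_mul_sub L (2 * tau) t).sub
      (hasDerivAt_exp_mul_sub L tau t)).const_mul k))
    have heq : ∀ s ∈ Ici t, modeFlow tau L k s = Complex.exp (L * s) + ((s - 2 * tau : ℝ) : ℂ) *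
        (k * (Complex.exp (L * (s - 2 * tau : ℝ)) - Complex.exp (L * (s - tau : ℝ)))) := by
      intro s hs
      rw [modeFlow, max_eq_left (by linarith [mem_Ici.1 hs])]
    refine (hctrl.hasDerivWithinAt.congr heq (heq t self_mem_Ici)).congr_deriv ?_
    rw [heq t self_mem_Ici, one_smul, Pi.sub_apply]
    ring
  · rw [zero_smul, add_zero, modeFlow_of_le (le_of_not_ge h)]
    refine (hexp.congr_of_eventuallyEq ?_).hasDerivWithinAt
    filter_upwards [Iio_mem_nhds (not_le.1 h)] with s hs
    exact modeFlow_of_le (le_of_lt hs)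

theorem hasDerivWithinAt_modeFlow_sub {ι : Type*} {L κ : ι → ℂ} (htau : 0 < tau) {k : ℕ}
    (ht : t ∈ Ico (3 * k * tau) (3 * k * tau + 3 * tau)) :
    let flow : ℝ → ι → ℂ := fun s i => modeFlow tau (L i) (κ i) (s - 3 * k * tau)
    HasDerivWithinAt flow (L * flow t +
      gainSwitch tau t • (κ * (flow (t - 2 * tau) - flow (t - tau)))) (Ici t) t := by
  have hswitch := gainSwitch_add htau k (sub_nonneg.2 ht.1) (by linarith [ht.2])
  rw [add_sub_cancel] at hswitch
  refine hasDerivWithinAt_pi.2 fun i => ?_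
  have hderiv := (hasDerivWithinAt_modeFlow (L := L i) (k := κ i) htau
    (t := t - 3 * k * tau) (by linarith [ht.2])).scomp (s := Ici t) t
    ((hasDerivAt_id t).sub_const (3 * k * tau)).hasDerivWithinAt fun s hs => sub_le_sub_right hs _
  simp only [one_smul, sub_right_comm t] at hderiv
  rwa [hswitch]

end ModeFlow

section ApproxModes

variable {ι : Type*} [Fintype ι]

/-- `z` satisfies the controlled delay equation for decoupled complex modes `L` with gains `κ` on
`[t₀, T)`, up to a relative error `η`, from a history bounded by `δ`. -/
structure IsApproxModeSolution (tau : ℝ) (L κ : ι → ℂ) (η t₀ T δ : ℝ) (z : ℝ → ι → ℂ) :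
    Prop where
  continuousOn : ContinuousOn z (Icc (t₀ - 2 * tau) T)
  history : ∀ s ∈ Icc (t₀ - 2 * tau) t₀, ‖z s‖ ≤ δ
  equation : ∀ t ∈ Ico t₀ T, ∃ e : ι → ℂ, ‖e‖ ≤ η * ‖z t‖ ∧ HasDerivWithinAt z
    (L * z t + e + gainSwitch tau t • (κ * (z (t - 2 * tau) - z (t - tau)))) (Ici t) t

theorem norm_le_gronwallBound_of_mode_equation {tau η ε a T δ t : ℝ} {L κ : ι → ℂ}
    {z : ℝ → ι → ℂ} (htau : 0 ≤ tau) (hη : 0 ≤ η) (hε : 0 ≤ ε) (hz : ContinuousOn z (Icc a T))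
    (heq : ∀ t ∈ Ico a T, ∃ e : ι → ℂ, ‖e‖ ≤ η * ‖z t‖ + ε ∧ HasDerivWithinAt z
      (L * z t + e + gainSwitch tau t • (κ * (z (t - 2 * tau) - z (t - tau)))) (Ici t) t)
    (ha : ‖z a‖ ≤ δ)
    (hhist : ∀ t ∈ Ico a T, gainSwitch tau t ≠ 0 → ∀ s ∈ Ico (t - 2 * tau) a, ‖z s‖ ≤ δ)
    (ht : t ∈ Icc a T) :
    ‖z t‖ ≤ gronwallBound δ (‖L‖ + η + 2 * ‖κ‖) ε (t - a) := by
  choose! e he hd using heq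
  refine norm_le_gronwallBound_of_delay (by positivity) hε hz hd ha ?_ ht
  intro s hs W hW hbound
  have hW₀ : 0 ≤ W := (norm_nonneg _).trans (ha.trans hW)
  have hzs : ‖z s‖ ≤ W := hbound s ⟨hs.1, le_rfl⟩
  have hfeedback : ‖gainSwitch tau s • (κ * (z (s - 2 * tau) - z (s - tau)))‖ ≤ 2 * ‖κ‖ * W := by
    rcases eq_or_ne (gainSwitch tau s) 0 with hoff | hon
    · rw [hoff, zero_smul, norm_zero]; positivity
    have hpast : ∀ r, s - 2 * tau ≤ r → r ≤ s → ‖z r‖ ≤ W := fun r hr₁ hr₂ => by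
      rcases lt_or_ge r a with hra | hra
      · exact (hhist s hs hon r ⟨hr₁, hra⟩).trans hW
      · exact hbound r ⟨hra, hr₂⟩
    calc ‖gainSwitch tau s • (κ * (z (s - 2 * tau) - z (s - tau)))‖
        ≤ 1 * (‖κ‖ * (‖z (s - 2 * tau)‖ + ‖z (s - tau)‖)) := by
          rw [norm_smul]
          gcongr
          · exact norm_gainSwitch_le_one tau s
          · exact (norm_mul_le _ _).trans (by gcongr; exact norm_sub_le _ _)
      _ ≤ 1 * (‖κ‖ * (W + W)) := by
          gcongr <;> exact hpast _ (by linarith) (by linarith)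
      _ = 2 * ‖κ‖ * W := by ring
  calc ‖L * z s + e s + gainSwitch tau s • (κ * (z (s - 2 * tau) - z (s - tau)))‖
      ≤ ‖L‖ * ‖z s‖ + (η * ‖z s‖ + ε) + 2 * ‖κ‖ * W :=
        norm_add₃_le.trans (add_le_add_three (norm_mul_le _ _) (he s hs) hfeedback)
    _ ≤ ‖L‖ * W + (η * W + ε) + 2 * ‖κ‖ * W := by gcongr
    _ = (‖L‖ + η + 2 * ‖κ‖) * W + ε := by ring

/-- A bound for the growth over one period of all mode solutions with relative error at most `1`. -/
def modeGrowth (tau : ℝ) (L κ : ι → ℂ) : ℝ := Real.exp ((‖L‖ + 1 + 2 * ‖κ‖) * (3 * tau))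

theorem one_le_modeGrowth {tau : ℝ} (htau : 0 ≤ tau) (L κ : ι → ℂ) : 1 ≤ modeGrowth tau L κ :=
  Real.one_le_exp (by positivity)

theorem gronwallBound_le_modeGrowth_mul {tau η δ s : ℝ} (L κ : ι → ℂ) (hη : η ≤ 1) (hδ : 0 ≤ δ)
    (hs₀ : 0 ≤ s) (hs : s ≤ 3 * tau) :
    gronwallBound δ (‖L‖ + η + 2 * ‖κ‖) 0 s ≤ modeGrowth tau L κ * δ := by
  rw [gronwallBound_ε0, mul_comm, modeGrowth]
  gcongr

/-- A bound for the factor by which a mode solution with relative error `η` grows over one control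
period: at `η = 0` it is the largest modulus of a multiplier. -/
def periodFactor (tau : ℝ) (L κ : ι → ℂ) (η : ℝ) : ℝ :=
  ‖fun i => modeMultiplier tau (L i) (κ i)‖ +
    η * (modeGrowth tau L κ * gronwallBound 0 (‖L‖ + 2 * ‖κ‖) 1 (3 * tau))

namespace IsApproxModeSolution

variable {tau η t₀ T δ : ℝ} {L κ : ι → ℂ} {z : ℝ → ι → ℂ}

theorem norm_le_of_le_add (h : IsApproxModeSolution tau L κ η t₀ T δ z) (htau : 0 < tau)
    (hη₀ : 0 ≤ η) (hη : η ≤ 1) {t : ℝ} (ht : t ∈ Icc t₀ T) (hts : t ≤ t₀ + 3 * tau) :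
    ‖z t‖ ≤ modeGrowth tau L κ * δ := by
  have hinit : ‖z t₀‖ ≤ δ := h.history t₀ (right_mem_Icc.2 (by linarith))
  refine (norm_le_gronwallBound_of_mode_equation (ε := 0) htau.le hη₀ le_rfl
    (h.continuousOn.mono (Icc_subset_Icc_left (by linarith)))
    (fun s hs => by simpa using h.equation s hs) hinit
    (fun s hs _ r hr => h.history r ⟨by linarith [hr.1, hs.1], hr.2.le⟩) ht).trans ?_
  exact gronwallBound_le_modeGrowth_mul L κ hη ((norm_nonneg _).trans hinit)
    (sub_nonneg.2 ht.1) (by linarith)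

theorem norm_le_mul_norm_period_start (h : IsApproxModeSolution tau L κ η t₀ T δ z) (htau : 0 < tau)
    (hη₀ : 0 ≤ η) (hη : η ≤ 1) {k : ℕ} (hk : t₀ ≤ 3 * k * tau) {t : ℝ}
    (ht : t ∈ Icc (3 * k * tau) T) (hts : t ≤ 3 * k * tau + 3 * tau) :
    ‖z t‖ ≤ modeGrowth tau L κ * ‖z (3 * k * tau)‖ := by
  refine (norm_le_gronwallBound_of_mode_equation (T := t) (ε := 0) htau.le hη₀ le_rfl
    (h.continuousOn.mono (Icc_subset_Icc (by linarith) ht.2))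
    (fun s hs => by simpa using h.equation s ⟨hk.trans hs.1, hs.2.trans_le ht.2⟩) le_rfl
    (fun s hs hon r hr => ?_) (right_mem_Icc.2 ht.1)).trans
    (gronwallBound_le_modeGrowth_mul L κ hη (norm_nonneg _) (sub_nonneg.2 ht.1) (by linarith))
  linarith [hr.1, hr.2, le_sub_of_gainSwitch_ne_zero htau
    (Ico_subset_Ico_right hts ⟨hs.1, hs.2⟩) hon]

theorem norm_sub_modeMultiplier_mul_le (h : IsApproxModeSolution tau L κ η t₀ T δ z)
    (htau : 0 < tau) (hη₀ : 0 ≤ η) (hη : η ≤ 1) {k : ℕ} (hk : t₀ ≤ 3 * k * tau)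
    (hT : 3 * k * tau + 3 * tau ≤ T) :
    ‖z (3 * k * tau + 3 * tau) - (fun i => modeMultiplier tau (L i) (κ i)) * z (3 * k * tau)‖ ≤
      η * (modeGrowth tau L κ * gronwallBound 0 (‖L‖ + 2 * ‖κ‖) 1 (3 * tau)) *
        ‖z (3 * k * tau)‖ := by
  set a : ℝ := 3 * k * tau
  set flow : ℝ → ι → ℂ := fun t i => modeFlow tau (L i) (κ i) (t - a) with hflow
  have hflowc : Continuous flow := continuous_pi fun i => continuous_modeFlow.comp (by fun_prop)
  have hflow_start : flow a = 1 := by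
    ext i; simp [hflow, modeFlow_of_le, htau.le]
  have hflow_end : flow (a + 3 * tau) = fun i => modeMultiplier tau (L i) (κ i) := by
    simp [hflow, modeMultiplier]
  have hdiff := norm_le_gronwallBound_of_mode_equation (z := fun t => z t - flow t * z a) (η := 0)
    (a := a) (L := L) (κ := κ) (T := a + 3 * tau) (ε := η * (modeGrowth tau L κ * ‖z a‖)) (δ := 0)
    htau.le le_rfl (by have := one_le_modeGrowth htau.le L κ; positivity)
    ((h.continuousOn.mono (Icc_subset_Icc (by linarith) hT)).sub
      (hflowc.continuousOn.mul continuousOn_const))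
    (fun t ht => by
      obtain ⟨e, he, hd⟩ := h.equation t ⟨hk.trans ht.1, ht.2.trans_le hT⟩
      refine ⟨e, ?_, (hd.sub
        ((hasDerivWithinAt_modeFlow_sub htau ht).mul_const (z a))).congr_deriv ?_⟩
      · rw [zero_mul, zero_add]
        refine he.trans (mul_le_mul_of_nonneg_left ?_ hη₀)
        exact h.norm_le_mul_norm_period_start htau hη₀ hη hk ⟨ht.1, (ht.2.trans_le hT).le⟩ ht.2.le
      · simp only [Algebra.smul_def]
        ring)
    (by simp [hflow_start])
    (fun s hs hon r hr => by
      linarith [hr.1, hr.2, le_sub_of_gainSwitch_ne_zero htau hs hon])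
    (right_mem_Icc.2 (by linarith))
  rw [gronwallBound_eq_add_mul, hflow_end] at hdiff
  refine hdiff.trans_eq ?_
  rw [add_zero, add_sub_cancel_left]
  ring

theorem norm_period_end_le (h : IsApproxModeSolution tau L κ η t₀ T δ z) (htau : 0 < tau)
    (hη₀ : 0 ≤ η) (hη : η ≤ 1) {k : ℕ} (hk : t₀ ≤ 3 * k * tau) (hT : 3 * k * tau + 3 * tau ≤ T) :
    ‖z (3 * k * tau + 3 * tau)‖ ≤ periodFactor tau L κ η * ‖z (3 * k * tau)‖ := by
  rw [periodFactor, add_mul]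
  exact (norm_le_insert' _ _).trans (add_le_add (norm_mul_le _ _)
    (h.norm_sub_modeMultiplier_mul_le htau hη₀ hη hk hT))

theorem norm_le_mul_exp_of_le_add (h : IsApproxModeSolution tau L κ η t₀ T δ z) (htau : 0 < tau)
    (hη₀ : 0 ≤ η) (hη : η ≤ 1) {α : ℝ} (hα : 0 ≤ α) {t : ℝ} (ht : t ∈ Icc t₀ T)
    (hts : t ≤ t₀ + 3 * tau) :
    ‖z t‖ ≤ modeGrowth tau L κ * Real.exp (α * (3 * tau)) * δ * Real.exp (-α * (t - t₀)) := by
  have hG := one_le_modeGrowth htau.le L κ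
  have hδ : 0 ≤ δ := (norm_nonneg _).trans (h.history t₀ (right_mem_Icc.2 (by linarith)))
  calc ‖z t‖ ≤ modeGrowth tau L κ * δ := h.norm_le_of_le_add htau hη₀ hη ht hts
    _ ≤ modeGrowth tau L κ * δ * Real.exp (α * (3 * tau) + -α * (t - t₀)) :=
      le_mul_of_one_le_right (by positivity) (Real.one_le_exp (by nlinarith))
    _ = _ := by rw [Real.exp_add]; ring

theorem norm_period_start_le (h : IsApproxModeSolution tau L κ η t₀ T δ z) (htau : 0 < tau)
    (hη₀ : 0 ≤ η) (hη : η ≤ 1) {α : ℝ} (hα : 0 ≤ α)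
    (hcontract : periodFactor tau L κ η ≤ Real.exp (-(α * (3 * tau)))) (ht₀ : 0 ≤ t₀) (k : ℕ)
    (hk : t₀ ≤ 3 * k * tau) (hT : 3 * k * tau ≤ T) :
    ‖z (3 * k * tau)‖ ≤
      modeGrowth tau L κ * Real.exp (α * (3 * tau)) * δ * Real.exp (-α * (3 * k * tau - t₀)) := by
  induction k with
  | zero => exact h.norm_le_mul_exp_of_le_add htau hη₀ hη hα ⟨hk, hT⟩ (by push_cast; linarith)
  | succ k ih =>
    rcases lt_or_ge (3 * (k : ℝ) * tau) t₀ with hlt | hge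
    · exact h.norm_le_mul_exp_of_le_add htau hη₀ hη hα ⟨hk, hT⟩ (by push_cast; linarith)
    have hstep : 3 * ((k + 1 : ℕ) : ℝ) * tau = 3 * k * tau + 3 * tau := by push_cast; ring
    rw [hstep] at hT ⊢
    calc ‖z (3 * k * tau + 3 * tau)‖
        ≤ Real.exp (-(α * (3 * tau))) * ‖z (3 * k * tau)‖ :=
          (h.norm_period_end_le htau hη₀ hη hge hT).trans (by gcongr)
      _ ≤ Real.exp (-(α * (3 * tau))) * (modeGrowth tau L κ * Real.exp (α * (3 * tau)) * δ *
            Real.exp (-α * (3 * k * tau - t₀))) := by gcongr; exact ih hge (by linarith)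
      _ = modeGrowth tau L κ * Real.exp (α * (3 * tau)) * δ *
            Real.exp (-(α * (3 * tau)) + -α * (3 * k * tau - t₀)) := by rw [Real.exp_add]; ring
      _ = _ := by ring_nf

theorem norm_le_mul_exp (h : IsApproxModeSolution tau L κ η t₀ T δ z) (htau : 0 < tau)
    (hη₀ : 0 ≤ η) (hη : η ≤ 1) {α : ℝ} (hα : 0 ≤ α)
    (hcontract : periodFactor tau L κ η ≤ Real.exp (-(α * (3 * tau)))) (ht₀ : 0 ≤ t₀) {t : ℝ}
    (ht : t ∈ Icc t₀ T) :
    ‖z t‖ ≤ (modeGrowth tau L κ * Real.exp (α * (3 * tau))) ^ 2 * δ * Real.exp (-α * (t - t₀)) := by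
  set C : ℝ := modeGrowth tau L κ * Real.exp (α * (3 * tau)) with hC
  have hG := one_le_modeGrowth htau.le L κ
  have hC₁ : 1 ≤ C := one_le_mul_of_one_le_of_one_le hG (Real.one_le_exp (by positivity))
  have hδ : 0 ≤ δ := (norm_nonneg _).trans (h.history t₀ (right_mem_Icc.2 (by linarith)))
  have h3tau : 0 < 3 * tau := by linarith
  set k : ℕ := ⌊t / (3 * tau)⌋₊
  have hk : 3 * k * tau ≤ t := by
    have := (le_div_iff₀ h3tau).1 (Nat.floor_le (div_nonneg (ht₀.trans ht.1) h3tau.le))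
    linarith
  have hk' : t ≤ 3 * k * tau + 3 * tau := by
    have := (div_lt_iff₀ h3tau).1 (Nat.lt_floor_add_one (t / (3 * tau)))
    linarith
  rcases lt_or_ge (3 * (k : ℝ) * tau) t₀ with hlt | hge
  · refine (h.norm_le_mul_exp_of_le_add htau hη₀ hη hα ht (by linarith)).trans ?_
    gcongr
    exact le_self_pow₀ hC₁ two_ne_zero
  · calc ‖z t‖ ≤ modeGrowth tau L κ * ‖z (3 * k * tau)‖ :=
        h.norm_le_mul_norm_period_start htau hη₀ hη hge ⟨hk, ht.2⟩ hk'
      _ ≤ modeGrowth tau L κ * (C * δ * Real.exp (-α * (3 * k * tau - t₀))) := by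
        gcongr
        exact h.norm_period_start_le htau hη₀ hη hα hcontract ht₀ k hge (hk.trans ht.2)
      _ ≤ modeGrowth tau L κ * (C * δ * Real.exp (α * (3 * tau) + -α * (t - t₀))) := by
        gcongr
        nlinarith
      _ = C ^ 2 * δ * Real.exp (-α * (t - t₀)) := by rw [Real.exp_add, hC]; ring

end IsApproxModeSolution

theorem exists_exponential_decay_of_norm_modeMultiplier_lt_one {tau : ℝ} (htau : 0 < tau)
    {L κ : ι → ℂ}
    (hmult : ∀ i, ‖modeMultiplier tau (L i) (κ i)‖ < 1) :
    ∃ η > 0, ∃ C > 0, ∃ α > 0, ∀ (t₀ T δ : ℝ) (z : ℝ → ι → ℂ), 0 ≤ t₀ →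
      IsApproxModeSolution tau L κ η t₀ T δ z →
        ∀ t ∈ Icc t₀ T, ‖z t‖ ≤ C * δ * Real.exp (-α * (t - t₀)) := by
  have hfactor₀ : periodFactor tau L κ 0 < 1 := by
    simpa [periodFactor] using (pi_norm_lt_iff zero_lt_one).2 hmult
  have hlim : ∀ᶠ η in 𝓝[>] (0 : ℝ), η < 1 ∧ periodFactor tau L κ η < 1 := by
    have hcont : Continuous (periodFactor tau L κ) := by unfold periodFactor; fun_prop
    exact nhdsWithin_le_nhds ((gt_mem_nhds one_pos).and (hcont.tendsto 0 (gt_mem_nhds hfactor₀)))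
  obtain ⟨η, ⟨hη₁, hηlt⟩, hη₀⟩ := (hlim.and self_mem_nhdsWithin).exists
  have hα : ∀ᶠ α in 𝓝[>] (0 : ℝ), periodFactor tau L κ η < Real.exp (-(α * (3 * tau))) := by
    have hcont : Continuous fun α => Real.exp (-(α * (3 * tau))) := by fun_prop
    exact nhdsWithin_le_nhds (hcont.tendsto 0 (lt_mem_nhds (by simpa using hηlt)))
  obtain ⟨α, hαlt, hα₀⟩ := (hα.and self_mem_nhdsWithin).exists
  have := one_le_modeGrowth htau.le L κ
  exact ⟨η, hη₀, (modeGrowth tau L κ * Real.exp (α * (3 * tau))) ^ 2, by positivity, α, hα₀,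
    fun t₀ T δ z ht₀ h t ht =>
      h.norm_le_mul_exp htau (le_of_lt hη₀) hη₁.le (le_of_lt hα₀) hαlt.le ht₀ ht⟩

end ApproxModes

/-! ### Existence of solutions by the method of steps -/

theorem exists_hasDerivWithinAt_of_bounded_lipschitz {E : Type*} [NormedAddCommGroup E]
    [NormedSpace ℝ E] [CompleteSpace E] {F : E → E} {L : NNReal} {M : ℝ} (hF : LipschitzWith L F)
    (hM : ∀ x, ‖F x‖ ≤ M) {g : ℝ → E} {a b : ℝ} (hab : a ≤ b) (hg : ContinuousOn g (Icc a b))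
    (x₀ : E) : ∃ y : ℝ → E, y a = x₀ ∧
      ∀ t ∈ Icc a b, HasDerivWithinAt y (F (y t) + g t) (Icc a b) t := by
  obtain ⟨C, hC⟩ := isCompact_Icc.exists_bound_of_continuousOn hg
  have hM₀ : 0 ≤ M := (norm_nonneg _).trans (hM x₀)
  have hC₀ : 0 ≤ C := (norm_nonneg _).trans (hC a ⟨le_rfl, hab⟩)
  have hba : 0 ≤ b - a := sub_nonneg.2 hab
  have hPL : IsPicardLindelof (fun t x => F x + g t) (⟨a, le_rfl, hab⟩ : Icc a b) x₀
      (Real.toNNReal ((M + C) * (b - a))) 0 (Real.toNNReal (M + C)) L := by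
    refine ⟨fun t _ => ?_, fun x _ => continuousOn_const.add hg, fun t ht x _ => ?_, ?_⟩
    · simpa using (hF.add (LipschitzWith.const (g t))).lipschitzOnWith
    · rw [Real.coe_toNNReal _ (by positivity)]
      exact norm_add_le_of_le (hM x) (hC t ht)
    · rw [Real.coe_toNNReal _ (by positivity), Real.coe_toNNReal _ (by positivity)]
      simp [hba]
  exact hPL.exists_eq_forall_mem_Icc_hasDerivWithinAt₀

theorem exists_eqOn_Iic_of_forall_exists_extension {α E : Type*} [Preorder α] {a : ℕ → α}
    (ha : Monotone a) (hreach : ∀ t, ∃ j, t ≤ a j) {P : ℕ → (α → E) → Prop} {u₀ : α → E}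
    (hu₀ : P 0 u₀) (hstep : ∀ j u, P j u → ∃ v, P (j + 1) v ∧ EqOn v u (Iic (a j))) :
    ∃ x, ∀ j, ∃ u, P j u ∧ EqOn x u (Iic (a j)) := by
  choose! next hnext hagree using hstep
  let u : ℕ → α → E := fun j => Nat.rec u₀ next j
  have hu : ∀ j, P j (u j) := fun j => by
    induction j with
    | zero => exact hu₀
    | succ j ih => exact hnext j _ ih
  have hu_le : ∀ i j, i ≤ j → EqOn (u j) (u i) (Iic (a i)) := fun i j hij => by
    induction j, hij using Nat.le_induction with
    | base => exact eqOn_refl _ _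
    | succ j hij ih =>
      exact ((hagree j _ (hu j)).mono (Iic_subset_Iic.2 (ha hij))).trans ih
  choose stage hstage using hreach
  refine ⟨fun t => u (stage t) t, fun j => ⟨u j, hu j, fun t ht => ?_⟩⟩
  rcases le_total (stage t) j with h | h
  · exact (hu_le _ _ h (hstage t)).symm
  · exact hu_le _ _ h ht

theorem exists_periodicGain_eq_on_Ico {n : ℕ} {tau : ℝ} (htau : 0 < tau)
    (K : Matrix (Fin n) (Fin n) ℝ) (j : ℕ) :
    ∃ Kj, ∀ t ∈ Ico (j * tau) ((j + 1) * tau), periodicGain tau K t = Kj := by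
  obtain ⟨k, i, hi, rfl⟩ : ∃ k i, i < 3 ∧ j = 3 * k + i :=
    ⟨j / 3, j % 3, Nat.mod_lt _ (by norm_num), (Nat.div_add_mod j 3).symm⟩
  refine ⟨(if 2 ≤ i then 1 else 0 : ℝ) • K, fun t ht => ?_⟩
  push_cast at ht
  have hlow : i * tau ≤ t - 3 * k * tau := by linarith [ht.1]
  have hupp : t - 3 * k * tau < (i + 1) * tau := by linarith [ht.2]
  have hi' : (i : ℝ) + 1 ≤ 3 := by exact_mod_cast hi
  have hswitch := gainSwitch_add htau k ((by positivity : 0 ≤ i * tau).trans hlow)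
    (hupp.trans_le (by gcongr))
  have hon : 2 * tau ≤ t - 3 * k * tau ↔ 2 ≤ i := by
    refine ⟨fun h => ?_, fun h => le_trans (by gcongr; exact_mod_cast h) hlow⟩
    have : (2 : ℝ) < i + 1 := lt_of_mul_lt_mul_right (h.trans_lt hupp) htau.le
    exact Nat.lt_succ_iff.1 (by exact_mod_cast this)
  rw [periodicGain_eq_smul, ← add_sub_cancel (3 * k * tau) t, hswitch]
  simp only [hon]

/-- `u` is continuous on the closed interval `[t₀ - 2 tau, a]` and solves the controlled equation
there with initial function `φ`: the induction hypothesis of the method of steps. -/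
structure IsSolutionUpTo {n : ℕ} (F : (Fin n → ℝ) → (Fin n → ℝ)) (tau : ℝ)
    (K : Matrix (Fin n) (Fin n) ℝ) (t₀ : ℝ) (φ : ℝ → Fin n → ℝ) (a : ℝ) (u : ℝ → Fin n → ℝ) :
    Prop where
  continuousOn : ContinuousOn u (Icc (t₀ - 2 * tau) a)
  initial : EqOn u φ (Icc (t₀ - 2 * tau) t₀)
  equation : ∀ t ∈ Ico t₀ a, HasDerivWithinAt u
    (F (u t) + (periodicGain tau K t).mulVec (u (t - 2 * tau) - u (t - tau))) (Ici t) t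

section MethodOfSteps

variable {n : ℕ} {F : (Fin n → ℝ) → (Fin n → ℝ)} {tau t₀ : ℝ} {K : Matrix (Fin n) (Fin n) ℝ}
  {φ : ℝ → Fin n → ℝ}

namespace IsSolutionUpTo

theorem congr {a : ℝ} {u v : ℝ → Fin n → ℝ} (hu : IsSolutionUpTo F tau K t₀ φ a u)
    (htau : 0 ≤ tau) (ha : t₀ ≤ a) (hv : EqOn v u (Iic a)) : IsSolutionUpTo F tau K t₀ φ a v where
  continuousOn := hu.continuousOn.congr (hv.mono Icc_subset_Iic_self)
  initial := (hv.mono fun _ ht => ht.2.trans ha).trans hu.initial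
  equation t ht := by
    have hpast : ∀ s ≤ t, v s = u s := fun s hs => hv (hs.trans ht.2.le)
    rw [hpast t le_rfl, hpast _ (by linarith), hpast _ (by linarith)]
    refine (hu.equation t ht).congr_of_eventuallyEq ?_ (hpast t le_rfl)
    exact nhdsWithin_le_nhds (hv.eventuallyEq_of_mem (Iic_mem_nhds ht.2))

theorem continuousOn_delay_mulVec {a b : ℝ} {u : ℝ → Fin n → ℝ}
    (hu : IsSolutionUpTo F tau K t₀ φ a u) (htau : 0 ≤ tau) (ha : t₀ ≤ a) (hb : b ≤ a + tau)
    (B : Matrix (Fin n) (Fin n) ℝ) :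
    ContinuousOn (fun t => B.mulVec (u (t - 2 * tau) - u (t - tau))) (Icc a b) := by
  have hdelay : ∀ d, tau ≤ d → d ≤ 2 * tau → ContinuousOn (fun t => u (t - d)) (Icc a b) :=
    fun d hd₁ hd₂ => hu.continuousOn.comp (by fun_prop) fun t ht =>
      ⟨by linarith [ht.1], by linarith [ht.2]⟩
  exact (Matrix.mulVecLin B).continuous_of_finiteDimensional.comp_continuousOn
    ((hdelay _ (by linarith) le_rfl).sub (hdelay _ le_rfl (by linarith)))

theorem exists_extension {L : NNReal} {M : ℝ} (hF : LipschitzWith L F) (hM : ∀ x, ‖F x‖ ≤ M)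
    (htau : 0 ≤ tau) {a b : ℝ} {u : ℝ → Fin n → ℝ} (hu : IsSolutionUpTo F tau K t₀ φ a u)
    (ha : t₀ ≤ a) (hab : a ≤ b) (hb : b ≤ a + tau) {Ka : Matrix (Fin n) (Fin n) ℝ}
    (hK : ∀ t ∈ Ico a b, periodicGain tau K t = Ka) :
    ∃ v, IsSolutionUpTo F tau K t₀ φ b v ∧ EqOn v u (Iic a) := by
  classical
  -- On `[a, b]` the delayed values are already known, so the equation is a forced ODE.
  obtain ⟨y, hya, hy⟩ := exists_hasDerivWithinAt_of_bounded_lipschitz hF hM hab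
    (hu.continuousOn_delay_mulVec htau ha hb Ka) (u a)
  let v : ℝ → Fin n → ℝ := (Iic a).piecewise u y
  have hvu : EqOn v u (Iic a) := piecewise_eqOn _ _ _
  have hvy : EqOn v y (Ici a) := fun t ht => by
    rcases (mem_Ici.1 ht).eq_or_lt with rfl | h
    · rw [hvu self_mem_Iic, hya]
    · exact piecewise_eq_of_notMem _ _ _ (not_le.2 h)
  have hva := hu.congr htau ha hvu
  refine ⟨v, ⟨?_, hva.initial, fun t ht => ?_⟩, hvu⟩
  · have hright : ContinuousOn v (Icc a b) := ContinuousOn.congr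
      (fun t ht => (hy t ht).continuousWithinAt) (hvy.mono Icc_subset_Ici_self)
    have hunion := hva.continuousOn.union_of_isClosed hright isClosed_Icc isClosed_Icc
    rwa [Icc_union_Icc_eq_Icc (by linarith) hab] at hunion
  · rcases lt_or_ge t a with h | h
    · exact hva.equation t ⟨ht.1, h⟩
    · have hyt := (hy t ⟨h, ht.2.le⟩).mono_of_mem_nhdsWithin
        (mem_of_superset (Icc_mem_nhdsGE ht.2) (Icc_subset_Icc_left h))
      rw [hK t ⟨h, ht.2⟩, hvy h, hvu (by simp; linarith [ht.2]), hvu (by simp; linarith [ht.2])]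
      exact hyt.congr (hvy.mono (Ici_subset_Ici.2 h)) (hvy h)

theorem isControlledSolution_Ici {x : ℝ → Fin n → ℝ} (htau : 0 ≤ tau) {a : ℕ → ℝ}
    (ha : Tendsto a atTop atTop) (hx : ∀ j, IsSolutionUpTo F tau K t₀ φ (a j) x) :
    IsControlledSolution F tau K t₀ φ (Ici t₀) x where
  continuousOn t ht := by
    obtain ⟨j, hj⟩ := (ha.eventually_gt_atTop t).exists
    have hsub : Icc (t₀ - 2 * tau) t₀ ∪ Ici t₀ ⊆ Ici (t₀ - 2 * tau) :=
      union_subset Icc_subset_Ici_self (Ici_subset_Ici.2 (by linarith))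
    refine (((hx j).continuousOn t ⟨hsub ht, hj.le⟩).mono_of_mem_nhdsWithin ?_).mono hsub
    rw [← Ici_inter_Iic]
    exact inter_mem self_mem_nhdsWithin (nhdsWithin_le_nhds (Iic_mem_nhds hj))
  initial := (hx 0).initial
  equation t ht := by
    obtain ⟨j, hj⟩ := (ha.eventually_gt_atTop t).exists
    exact (hx j).equation t ⟨ht, hj⟩

end IsSolutionUpTo

theorem exists_isControlledSolution {L : NNReal} {M : ℝ} (hF : LipschitzWith L F)
    (hM : ∀ x, ‖F x‖ ≤ M) (htau : 0 < tau) (ht₀ : 0 ≤ t₀)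
    (hφ : ContinuousOn φ (Icc (t₀ - 2 * tau) t₀)) :
    ∃ x, IsControlledSolution F tau K t₀ φ (Ici t₀) x := by
  let a : ℕ → ℝ := fun j => max t₀ (j * tau)
  have ha : ∀ j, t₀ ≤ a j := fun j => le_max_left _ _
  have ha_mono : Monotone a := fun i j hij => max_le_max_left _ (by gcongr)
  have ha_tendsto : Tendsto a atTop atTop := tendsto_atTop_mono (fun j => le_max_right _ _)
    (tendsto_natCast_atTop_atTop.atTop_mul_const htau)
  have hbase : IsSolutionUpTo F tau K t₀ φ (a 0) φ := by
    have ha₀ : a 0 = t₀ := by simp [a, ht₀]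
    rw [ha₀]
    exact ⟨hφ, eqOn_refl _ _, fun t ht => by simp at ht⟩
  have hstep : ∀ j u, IsSolutionUpTo F tau K t₀ φ (a j) u →
      ∃ v, IsSolutionUpTo F tau K t₀ φ (a (j + 1)) v ∧ EqOn v u (Iic (a j)) := by
    intro j u hu
    obtain ⟨Kj, hKj⟩ := exists_periodicGain_eq_on_Ico htau K j
    have hj : (j : ℝ) * tau ≤ a j := le_max_right _ _
    refine hu.exists_extension hF hM htau.le (ha j) (ha_mono j.le_succ) (max_le ?_ ?_)
      fun t ht => hKj t ⟨hj.trans ht.1, ?_⟩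
    · linarith [ha j]
    · push_cast; linarith
    · exact_mod_cast (lt_max_iff.1 ht.2).resolve_left (not_lt.2 ((ha j).trans ht.1))
  obtain ⟨x, hx⟩ := exists_eqOn_Iic_of_forall_exists_extension ha_mono
    (fun t => (ha_tendsto.eventually_ge_atTop t).exists) hbase hstep
  refine ⟨x, IsSolutionUpTo.isControlledSolution_Ici htau.le ha_tendsto fun j => ?_⟩
  obtain ⟨u, hu, hxu⟩ := hx j
  exact hu.congr htau.le (ha j) hxu

end MethodOfSteps

section LipschitzExtension

variable {ι : Type*} [Fintype ι]

/-- The coordinatewise retraction of `ι → ℝ` onto the closed ball of radius `r` about `c` in the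
maximum norm, for `0 ≤ r`. -/
def ballClamp (c : ι → ℝ) (r : ℝ) (x : ι → ℝ) : ι → ℝ :=
  fun i => max (c i - r) (min (c i + r) (x i))

theorem lipschitzWith_ballClamp (c : ι → ℝ) (r : ℝ) : LipschitzWith 1 (ballClamp c r) :=
  LipschitzWith.of_dist_le_mul fun x y => by
    rw [NNReal.coe_one, one_mul]
    refine (dist_pi_le_iff dist_nonneg).2 fun i => ?_
    have h := ((LipschitzWith.eval i (α := fun _ : ι => ℝ)).const_min (c i + r)).const_max (c i - r)
    simpa [ballClamp] using h.dist_le_mul x y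

theorem ballClamp_mem_closedBall (c x : ι → ℝ) {r : ℝ} (hr : 0 ≤ r) :
    ballClamp c r x ∈ Metric.closedBall c r := by
  refine (dist_pi_le_iff hr).2 fun i => ?_
  rw [Real.dist_eq, abs_le]
  have hlow : c i - r ≤ ballClamp c r x i := le_max_left _ _
  have hupp : ballClamp c r x i ≤ c i + r := max_le (by linarith) (min_le_left _ _)
  constructor <;> linarith

theorem ballClamp_eq_self {c x : ι → ℝ} {r : ℝ} (hx : x ∈ Metric.closedBall c r) :
    ballClamp c r x = x := by
  funext i
  have hi := (dist_le_pi_dist x c i).trans hx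
  rw [Real.dist_eq, abs_le] at hi
  rw [ballClamp, min_eq_right (by linarith), max_eq_right (by linarith)]

theorem exists_bounded_lipschitzWith_extension {E : Type*} [SeminormedAddCommGroup E]
    {f : (ι → ℝ) → E} {c : ι → ℝ} {r : ℝ} (hr : 0 ≤ r) {L : NNReal}
    (hf : LipschitzOnWith L f (Metric.closedBall c r)) :
    ∃ F : (ι → ℝ) → E, LipschitzWith L F ∧ (∃ M, ∀ x, ‖F x‖ ≤ M) ∧
      EqOn F f (Metric.closedBall c r) := by
  have hmem := fun x => ballClamp_mem_closedBall c x hr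
  refine ⟨f ∘ ballClamp c r, ?_, ⟨‖f c‖ + L * r, fun x => ?_⟩, fun x hx => ?_⟩
  · simpa [lipschitzOnWith_univ] using
      hf.comp ((lipschitzWith_ballClamp c r).lipschitzOnWith (s := univ)) fun x _ => hmem x
  · have hdist := hf.norm_sub_le (hmem x) (Metric.mem_closedBall_self hr)
    have hclamp : ‖ballClamp c r x - c‖ ≤ r := by simpa [dist_eq_norm] using hmem x
    calc ‖f (ballClamp c r x)‖ ≤ ‖f c‖ + ‖f (ballClamp c r x) - f c‖ := norm_le_insert' _ _
      _ ≤ ‖f c‖ + L * r := by gcongr; exact hdist.trans (by gcongr)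
  · simp [ballClamp_eq_self hx]

end LipschitzExtension

/-! ### From stable modes to local asymptotic stability -/

theorem norm_lt_of_trapped {E : Type*} [SeminormedAddGroup E] {z : ℝ → E} {t₀ T r : ℝ}
    (hz : ContinuousOn z (Ico t₀ T))
    (htrap : ∀ t ∈ Ico t₀ T, (∀ s ∈ Ico t₀ t, ‖z s‖ < r) → ‖z t‖ < r) :
    ∀ t ∈ Ico t₀ T, ‖z t‖ < r := by
  intro t ht
  by_contra! hexit
  have hzt : ContinuousOn (fun s => ‖z s‖) (Icc t₀ t) :=
    (hz.mono (Icc_subset_Ico_right ht.2)).norm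
  have hcompact : IsCompact (Icc t₀ t ∩ (fun s => ‖z s‖) ⁻¹' Ici r) :=
    isCompact_Icc.of_isClosed_subset (hzt.preimage_isClosed_of_isClosed isClosed_Icc isClosed_Ici)
      inter_subset_left
  obtain ⟨u, hu, hfirst⟩ := hcompact.exists_isLeast ⟨t, ⟨ht.1, le_rfl⟩, hexit⟩
  refine (htrap u ⟨hu.1.1, hu.1.2.trans_lt ht.2⟩ fun s hs => ?_).not_ge hu.2
  by_contra! hs'
  exact (hfirst ⟨⟨hs.1, hs.2.le.trans hu.1.2⟩, hs'⟩).not_gt hs.2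

/-- Every solution with a history `δ`-close to `xs` satisfies
`‖x t - xs‖ ≤ C δ exp (-α (t - t₀))` as long as it exists, for `δ` small and with constants
that depend on neither `δ` nor the initial time `t₀`. -/
def IsLocallyExponentiallyStable {n : ℕ} (f : (Fin n → ℝ) → (Fin n → ℝ)) (tau : ℝ)
    (K : Matrix (Fin n) (Fin n) ℝ) (xs : Fin n → ℝ) : Prop :=
  ∃ C > 0, ∃ α > 0, ∃ r > 0, ∀ δ ∈ Ioo 0 r, ∀ t₀ ≥ 0, ∀ φ, IsSmallHistory tau t₀ xs δ φ →
    ∀ T x, IsControlledSolution f tau K t₀ φ (Ico t₀ T) x →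
      ∀ t ∈ Ico t₀ T, ‖x t - xs‖ ≤ C * δ * Real.exp (-α * (t - t₀))

/-- The coordinates `Φ` turn the gain `K` into the diagonal gain `κ` and the matrix `A` into the
diagonal matrix `L`, the latter up to the relative error `η`. -/
structure IsApproxModeCoordinates {n : ℕ} {ι : Type*} [Fintype ι] (A K : Matrix (Fin n) (Fin n) ℝ)
    (L κ : ι → ℂ) (η : ℝ) (Φ : (Fin n → ℝ) →ₗ[ℝ] (ι → ℂ)) : Prop where
  injective : Function.Injective Φ
  map_gain : ∀ v, Φ (K.mulVec v) = κ * Φ v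
  norm_sub_le : ∀ v, ‖Φ (A.mulVec v) - L * Φ v‖ ≤ η * ‖Φ v‖

section Stability

variable {n : ℕ} {f : (Fin n → ℝ) → (Fin n → ℝ)} {tau : ℝ} {A K : Matrix (Fin n) (Fin n) ℝ}
  {xs : Fin n → ℝ}

theorem IsControlledSolution.mono {t₀ : ℝ} {φ x : ℝ → Fin n → ℝ} {S S' : Set ℝ}
    (hx : IsControlledSolution f tau K t₀ φ S x) (hS : S' ⊆ S) :
    IsControlledSolution f tau K t₀ φ S' x :=
  ⟨hx.continuousOn.mono (union_subset_union_right _ hS), hx.initial,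
    fun t ht => hx.equation t (hS ht)⟩

section Modes

variable {ι : Type*} [Fintype ι] {L κ : ι → ℂ} {η η' : ℝ} {Φ : (Fin n → ℝ) →ₗ[ℝ] (ι → ℂ)}

theorem IsApproxModeCoordinates.exists_norm_map_sub_le
    (hΦ : IsApproxModeCoordinates A K L κ η Φ) (hη : η < η') (hA : IsJacobianAt f A xs)
    (hxs : f xs = 0) : ∃ r > 0, ∀ x, ‖Φ (x - xs)‖ < r →
      ‖Φ (f x) - L * Φ (x - xs)‖ ≤ η' * ‖Φ (x - xs)‖ := by
  obtain ⟨c, hc, hanti⟩ := Φ.injective_iff_antilipschitz.1 hΦ.injective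
  have hleΦ : ∀ v, ‖v‖ ≤ c * ‖Φ v‖ := fun v => by simpa using hanti.le_mul_dist v 0
  have hremainder : (fun x => Φ (f x) - Φ (A.mulVec (x - xs))) =o[𝓝 xs] fun x => Φ (x - xs) := by
    have hcomp := (LinearMap.toContinuousLinearMap Φ).hasFDerivAt.comp xs hA
    refine (hcomp.isLittleO.congr_left fun x => ?_).trans_isBigO
      (Asymptotics.IsBigO.of_bound c (Eventually.of_forall fun x => hleΦ _))
    simp [hxs]
  obtain ⟨r, hr, hball⟩ := Metric.eventually_nhds_iff.1 (hremainder.bound (sub_pos.2 hη))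
  refine ⟨r / c, by positivity, fun x hx => ?_⟩
  have hdist : dist x xs < r :=
    (dist_eq_norm x xs).trans_lt ((hleΦ _).trans_lt ((lt_div_iff₀' (by positivity)).1 hx))
  calc ‖Φ (f x) - L * Φ (x - xs)‖
      ≤ ‖Φ (f x) - Φ (A.mulVec (x - xs))‖ + ‖Φ (A.mulVec (x - xs)) - L * Φ (x - xs)‖ :=
        norm_sub_le_norm_sub_add_norm_sub _ _ _
    _ ≤ (η' - η) * ‖Φ (x - xs)‖ + η * ‖Φ (x - xs)‖ := add_le_add (hball hdist) (hΦ.norm_sub_le _)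
    _ = η' * ‖Φ (x - xs)‖ := by ring

theorem IsControlledSolution.isApproxModeSolution {δ t₀ t₁ T : ℝ} {φ x : ℝ → Fin n → ℝ}
    (hx : IsControlledSolution f tau K t₀ φ (Ico t₀ T) x) (hK : ∀ v, Φ (K.mulVec v) = κ * Φ v)
    (hhist : ∀ s ∈ Icc (t₀ - 2 * tau) t₀, ‖Φ (x s - xs)‖ ≤ δ) (ht₁ : t₁ ∈ Ico t₀ T)
    (hf : ∀ s ∈ Ico t₀ t₁, ‖Φ (f (x s)) - L * Φ (x s - xs)‖ ≤ η * ‖Φ (x s - xs)‖) :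
    IsApproxModeSolution tau L κ η t₀ t₁ δ fun t => Φ (x t - xs) where
  continuousOn := by
    refine Φ.continuous_of_finiteDimensional.comp_continuousOn
      ((hx.continuousOn.mono fun t ht => ?_).sub continuousOn_const)
    exact (le_total t t₀).imp (fun h => ⟨ht.1, h⟩) fun h => ⟨h, ht.2.trans_lt ht₁.2⟩
  history := hhist
  equation t ht := by
    refine ⟨_, hf t ht, ?_⟩
    have hderiv := (LinearMap.toContinuousLinearMap Φ).hasFDerivAt.comp_hasDerivWithinAt t
      ((hx.equation t ⟨ht.1, ht.2.trans ht₁.2⟩).sub_const xs)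
    refine hderiv.congr_deriv ?_
    rw [add_sub_cancel, LinearMap.coe_toContinuousLinearMap', map_add, periodicGain_eq_smul,
      Matrix.smul_mulVec, map_smul, hK, ← map_sub, sub_sub_sub_cancel_right]

theorem isLocallyExponentiallyStable_of_modes (hA : IsJacobianAt f A xs) (hxs : f xs = 0)
    (htau : 0 < tau) (hmult : ∀ i, ‖modeMultiplier tau (L i) (κ i)‖ < 1)
    (hmodes : ∀ η > 0, ∃ Φ, IsApproxModeCoordinates A K L κ η Φ) :
    IsLocallyExponentiallyStable f tau K xs := by
  obtain ⟨η, hη, C, hC, α, hα, hdecay⟩ :=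
    exists_exponential_decay_of_norm_modeMultiplier_lt_one htau hmult
  obtain ⟨Φ, hΦ⟩ := hmodes (η / 2) (half_pos hη)
  obtain ⟨r, hr, hfr⟩ := hΦ.exists_norm_map_sub_le (half_lt_self hη) hA hxs
  obtain ⟨c₁, hc₁, hΦle⟩ := (LinearMap.toContinuousLinearMap Φ).bound
  obtain ⟨c₂, hc₂, hanti⟩ := Φ.injective_iff_antilipschitz.1 hΦ.injective
  have hleΦ : ∀ v, ‖v‖ ≤ c₂ * ‖Φ v‖ := fun v => by simpa using hanti.le_mul_dist v 0
  refine ⟨c₂ * C * c₁, by positivity, α, hα, r / (C * c₁), by positivity, ?_⟩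
  intro δ ⟨hδ₀, hδ⟩ t₀ ht₀ φ hφ T x hx t ht
  have hhist : ∀ s ∈ Icc (t₀ - 2 * tau) t₀, ‖Φ (x s - xs)‖ ≤ c₁ * δ := fun s hs => by
    rw [hx.initial hs]
    exact (hΦle _).trans (by gcongr; exact (hφ.2 s hs).le)
  have hdecay_of_lt : ∀ t ∈ Ico t₀ T, (∀ s ∈ Ico t₀ t, ‖Φ (x s - xs)‖ < r) →
      ‖Φ (x t - xs)‖ ≤ C * (c₁ * δ) * Real.exp (-α * (t - t₀)) := fun t ht hlt =>
    hdecay t₀ t _ _ ht₀ (hx.isApproxModeSolution hΦ.map_gain hhist ht fun s hs => hfr _ (hlt s hs))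
      t (right_mem_Icc.2 ht.1)
  have hcont : ContinuousOn (fun t => Φ (x t - xs)) (Ico t₀ T) :=
    Φ.continuous_of_finiteDimensional.comp_continuousOn
      ((hx.continuousOn.mono subset_union_right).sub continuousOn_const)
  have hlt : ∀ s ∈ Ico t₀ T, ‖Φ (x s - xs)‖ < r := norm_lt_of_trapped hcont fun t ht hlt => by
    have hexp : Real.exp (-α * (t - t₀)) ≤ 1 :=
      Real.exp_le_one_iff.2 (by nlinarith [mul_nonneg hα.le (sub_nonneg.2 ht.1)])
    calc ‖Φ (x t - xs)‖ ≤ C * (c₁ * δ) * 1 := (hdecay_of_lt t ht hlt).trans (by gcongr)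
      _ = δ * (C * c₁) := by ring
      _ < r := (lt_div_iff₀ (by positivity)).1 hδ
  calc ‖x t - xs‖ ≤ c₂ * (C * (c₁ * δ) * Real.exp (-α * (t - t₀))) :=
        (hleΦ _).trans (by
          gcongr; exact hdecay_of_lt t ht fun s hs => hlt s ⟨hs.1, hs.2.trans ht.2⟩)
    _ = c₂ * C * c₁ * δ * Real.exp (-α * (t - t₀)) := by ring

end Modes

namespace IsLocallyExponentiallyStable

theorem exists_norm_sub_le (h : IsLocallyExponentiallyStable f tau K xs) {ε : ℝ} (hε : 0 < ε) :
    ∃ δ > 0, ∃ α > 0, ∀ t₀ ≥ 0, ∀ φ, IsSmallHistory tau t₀ xs δ φ → ∀ T x,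
      IsControlledSolution f tau K t₀ φ (Ico t₀ T) x →
        ∀ t ∈ Ico t₀ T, ‖x t - xs‖ ≤ ε * Real.exp (-α * (t - t₀)) := by
  obtain ⟨C, hC, α, hα, r, hr, hdecay⟩ := h
  refine ⟨min (r / 2) (ε / C), by positivity, α, hα, fun t₀ ht₀ φ hφ T x hx t ht => ?_⟩
  have hδ : min (r / 2) (ε / C) ∈ Ioo 0 r :=
    ⟨by positivity, (min_le_left _ _).trans_lt (half_lt_self hr)⟩
  refine (hdecay _ hδ t₀ ht₀ φ hφ T x hx t ht).trans ?_
  gcongr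
  exact (le_div_iff₀' hC).1 (min_le_right _ _)

theorem exists_norm_sub_lt (h : IsLocallyExponentiallyStable f tau K xs) {ε : ℝ} (hε : 0 < ε) :
    ∃ δ > 0, ∀ t₀ ≥ 0, ∀ φ, IsSmallHistory tau t₀ xs δ φ → ∀ T x,
      IsControlledSolution f tau K t₀ φ (Ico t₀ T) x → ∀ t ∈ Ico t₀ T, ‖x t - xs‖ < ε := by
  obtain ⟨δ, hδ, α, hα, hdecay⟩ := h.exists_norm_sub_le (half_pos hε)
  refine ⟨δ, hδ, fun t₀ ht₀ φ hφ T x hx t ht => (hdecay t₀ ht₀ φ hφ T x hx t ht).trans_lt ?_⟩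
  have hexp : Real.exp (-α * (t - t₀)) ≤ 1 :=
    Real.exp_le_one_iff.2 (by nlinarith [mul_nonneg hα.le (sub_nonneg.2 ht.1)])
  nlinarith

theorem isLocallyAsymptoticallyStable (h : IsLocallyExponentiallyStable f tau K xs)
    (hexists : ∃ δ > 0, ∀ t₀ ≥ 0, ∀ φ, IsSmallHistory tau t₀ xs δ φ →
      ∃ x, IsControlledSolution f tau K t₀ φ (Ici t₀) x) :
    IsLocallyAsymptoticallyStable f tau K xs := by
  refine ⟨fun ε hε => ?_, ?_⟩
  · obtain ⟨δ, hδ, hlt⟩ := h.exists_norm_sub_lt hε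
    exact ⟨δ, hδ, fun t₀ ht₀ φ hφ T _ => hlt t₀ ht₀ φ hφ T⟩
  obtain ⟨δ₁, hδ₁, hexists⟩ := hexists
  obtain ⟨δ₂, hδ₂, α, hα, hdecay⟩ := h.exists_norm_sub_le one_pos
  refine ⟨min δ₁ δ₂, by positivity, fun t₀ ht₀ φ hφ =>
    ⟨hexists t₀ ht₀ φ ⟨hφ.1, fun s hs => (hφ.2 s hs).trans_le (min_le_left _ _)⟩, fun x hx => ?_⟩⟩
  have hbound : ∀ t ∈ Ici t₀, ‖x t - xs‖ ≤ 1 * Real.exp (-α * (t - t₀)) := fun t ht =>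
    hdecay t₀ ht₀ φ ⟨hφ.1, fun s hs => (hφ.2 s hs).trans_le (min_le_right _ _)⟩ (t + 1) x
      (hx.mono Ico_subset_Ici_self) t ⟨ht, lt_add_one t⟩
  have hzero : Tendsto (fun t => 1 * Real.exp (-α * (t - t₀))) atTop (𝓝 0) := by
    simp only [one_mul, neg_mul]
    exact Real.tendsto_exp_neg_atTop_nhds_zero.comp
      ((tendsto_atTop_add_const_right _ _ tendsto_id).const_mul_atTop hα)
  rw [tendsto_iff_norm_sub_tendsto_zero]
  exact squeeze_zero' (Eventually.of_forall fun t => norm_nonneg _)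
    ((eventually_ge_atTop t₀).mono hbound) hzero

theorem exists_isControlledSolution_of_eqOn {F : (Fin n → ℝ) → (Fin n → ℝ)} {r M : ℝ} {L : NNReal}
    (hF : IsLocallyExponentiallyStable F tau K xs) (hL : LipschitzWith L F) (hM : ∀ x, ‖F x‖ ≤ M)
    (hr : 0 < r) (hFf : EqOn F f (Metric.closedBall xs r)) (htau : 0 < tau) :
    ∃ δ > 0, ∀ t₀ ≥ 0, ∀ φ, IsSmallHistory tau t₀ xs δ φ →
      ∃ x, IsControlledSolution f tau K t₀ φ (Ici t₀) x := by
  obtain ⟨δ, hδ, hlt⟩ := hF.exists_norm_sub_lt hr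
  refine ⟨δ, hδ, fun t₀ ht₀ φ hφ => ?_⟩
  obtain ⟨x, hx⟩ := exists_isControlledSolution (K := K) hL hM htau ht₀ hφ.1
  refine ⟨x, hx.continuousOn, hx.initial, fun t ht => ?_⟩
  rw [← hFf (mem_closedBall_iff_norm.2 (hlt t₀ ht₀ φ hφ (t + 1) x (hx.mono Ico_subset_Ici_self) t
    ⟨ht, lt_add_one t⟩).le)]
  exact hx.equation t ht

end IsLocallyExponentiallyStable

theorem isLocallyAsymptoticallyStable_of_modes {ι : Type*} [Fintype ι] {L κ : ι → ℂ} {r : ℝ}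
    {Lip : NNReal} (hr : 0 < r) (hf : LipschitzOnWith Lip f (Metric.closedBall xs r))
    (hA : IsJacobianAt f A xs) (hxs : f xs = 0) (htau : 0 < tau)
    (hmult : ∀ i, ‖modeMultiplier tau (L i) (κ i)‖ < 1)
    (hmodes : ∀ η > 0, ∃ Φ, IsApproxModeCoordinates A K L κ η Φ) :
    IsLocallyAsymptoticallyStable f tau K xs := by
  -- Solutions of the globally Lipschitz extension `F` exist and remain where `F` agrees with `f`.
  obtain ⟨F, hFLip, ⟨M, hM⟩, hFf⟩ := exists_bounded_lipschitzWith_extension hr.le hf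
  have hFA : IsJacobianAt F A xs :=
    HasFDerivAt.congr_of_eventuallyEq hA
      (hFf.eventuallyEq_of_mem (Metric.closedBall_mem_nhds xs hr))
  have hFxs : F xs = 0 := (hFf (Metric.mem_closedBall_self hr.le)).trans hxs
  have hfStable := isLocallyExponentiallyStable_of_modes hA hxs htau hmult hmodes
  have hFStable := isLocallyExponentiallyStable_of_modes hFA hFxs htau hmult hmodes
  exact hfStable.isLocallyAsymptoticallyStable
    (hFStable.exists_isControlledSolution_of_eqOn hFLip hM hr hFf htau)

end Stability

/-! ### Multiplier placement -/

/-- The gain that gives the scalar mode `L` the multiplier `Z` over one control period. -/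
def placementGain (tau : ℝ) (L Z : ℂ) : ℂ :=
  (Complex.exp (L * tau) ^ 3 - Z) / (tau * Complex.exp (L * tau) * (Complex.exp (L * tau) - 1))

section Placement

variable {tau : ℝ}

theorem modeMultiplier_eq (htau : 0 ≤ tau) (L k : ℂ) :
    modeMultiplier tau L k = Complex.exp (L * tau) ^ 3 +
      tau * k * (Complex.exp (L * tau) - Complex.exp (L * tau) ^ 2) := by
  have hpow : ∀ j : ℕ, Complex.exp (L * (j * tau : ℝ)) = Complex.exp (L * tau) ^ j := fun j => by
    rw [← Complex.exp_nat_mul]; push_cast; ring_nf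
  have h2 := hpow 2
  have h3 := hpow 3
  push_cast at h2 h3
  rw [modeMultiplier, modeFlow, show 3 * tau - 2 * tau = tau by ring,
    show 3 * tau - tau = 2 * tau by ring, max_eq_left htau]
  push_cast
  rw [h2, h3]
  ring

theorem exp_mul_ne_one (htau : tau ≠ 0) {L : ℂ} (hL : L.re ≠ 0) : Complex.exp (L * tau) ≠ 1 := by
  intro h
  have hnorm := congrArg norm h
  rw [Complex.norm_exp, norm_one, Real.exp_eq_one_iff] at hnorm
  simp [hL, htau] at hnorm

theorem modeMultiplier_placementGain (htau : 0 < tau) {L : ℂ} (hL : L.re ≠ 0) (Z : ℂ) :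
    modeMultiplier tau L (placementGain tau L Z) = Z := by
  have htau' : (tau : ℂ) ≠ 0 := Complex.ofReal_ne_zero.2 htau.ne'
  have hsub := sub_ne_zero.2 (exp_mul_ne_one htau.ne' hL)
  have hexp := Complex.exp_ne_zero (L * tau)
  rw [modeMultiplier_eq htau.le, placementGain]
  field_simp
  ring

theorem norm_modeMultiplier_zero_lt_one (htau : 0 < tau) {L : ℂ} (hL : L.re < 0) :
    ‖modeMultiplier tau L 0‖ < 1 := by
  rw [modeMultiplier_eq htau.le, mul_zero, zero_mul, add_zero, norm_pow, Complex.norm_exp]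
  refine pow_lt_one₀ (Real.exp_pos _).le (Real.exp_lt_one_iff.2 ?_) three_ne_zero
  simpa using mul_neg_of_neg_of_pos hL htau

theorem ofReal_realGain (tau lam zeta : ℝ) :
    (realGain tau lam zeta : ℂ) = placementGain tau lam zeta := by
  have h3 : Real.exp (3 * lam * tau) = Real.exp (lam * tau) ^ 3 := by
    rw [← Real.exp_nat_mul]; push_cast; ring_nf
  rw [realGain, placementGain, h3, neg_mul, Real.exp_neg]
  push_cast
  simp only [div_eq_mul_inv, mul_inv]
  ring

theorem ofReal_complexGainDenom (tau mu om : ℝ) :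
    (complexGainDenom tau mu om : ℂ) = tau * Complex.exp (mu * tau) *
      ((1 - Complex.exp ((mu + om * Complex.I) * tau)) *
        (1 - Complex.exp ((mu - om * Complex.I) * tau))) := by
  have hcos : 2 * (Real.cos (om * tau) : ℂ) =
      Complex.exp (om * tau * Complex.I) + Complex.exp (-(om * tau) * Complex.I) := by
    rw [Complex.ofReal_cos, Complex.two_cos]; push_cast; rfl
  have hsplit : ∀ s : ℂ, Complex.exp ((mu + s * Complex.I) * tau) =
      Complex.exp (mu * tau) * Complex.exp (s * tau * Complex.I) := fun s => by
    rw [← Complex.exp_add]; ring_nf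
  have hinv : Complex.exp (om * tau * Complex.I) * Complex.exp (-(om * tau) * Complex.I) = 1 := by
    rw [← Complex.exp_add]; simp
  have hsq : Complex.exp (2 * mu * tau) = Complex.exp (mu * tau) ^ 2 := by
    rw [← Complex.exp_nat_mul]; push_cast; ring_nf
  rw [sub_eq_add_neg (mu : ℂ), ← neg_mul, hsplit, hsplit, neg_mul (om : ℂ), complexGainDenom]
  push_cast at hcos ⊢
  rw [hsq]
  linear_combination (tau * Complex.exp (mu * tau) * -Complex.exp (mu * tau)) * hcos -
    tau * Complex.exp (mu * tau) * Complex.exp (mu * tau) ^ 2 * hinv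

theorem complexGain₁_add_complexGain₂_mul_I (tau mu om rho theta : ℝ) :
    (complexGain₁ tau mu om rho theta + complexGain₂ tau mu om rho theta * Complex.I : ℂ) =
      (rho * Complex.exp ((theta - om * tau) * Complex.I)
        - rho * Complex.exp (mu * tau) * Complex.exp ((theta - 2 * om * tau) * Complex.I)
        - Complex.exp (3 * mu * tau) * Complex.exp (2 * om * tau * Complex.I)
        + Complex.exp (4 * mu * tau) * Complex.exp (om * tau * Complex.I)) /
      complexGainDenom tau mu om := by
  simp only [complexGain₁, complexGain₂, Complex.exp_mul_I]
  push_cast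
  ring

theorem complexGain_eq_placementGain (htau : tau ≠ 0) {mu : ℝ} (hmu : mu ≠ 0) (om rho theta : ℝ) :
    (complexGain₁ tau mu om rho theta + complexGain₂ tau mu om rho theta * Complex.I : ℂ) =
      placementGain tau (mu + om * Complex.I) (rho * Complex.exp (theta * Complex.I)) := by
  set R := Complex.exp (mu * tau) with hR
  set W := Complex.exp (om * tau * Complex.I) with hW
  have hE : Complex.exp ((mu + om * Complex.I) * tau) = R * W := by
    rw [hR, hW, ← Complex.exp_add]; ring_nf
  have hE' : Complex.exp ((mu - om * Complex.I) * tau) = R / W := by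
    rw [hR, hW, ← Complex.exp_sub]; ring_nf
  have h₁ : Complex.exp ((theta - om * tau) * Complex.I) = Complex.exp (theta * Complex.I) / W := by
    rw [hW, ← Complex.exp_sub]; ring_nf
  have h₂ : Complex.exp ((theta - 2 * om * tau) * Complex.I) =
      Complex.exp (theta * Complex.I) / W ^ 2 := by
    rw [hW, ← Complex.exp_nat_mul, ← Complex.exp_sub]; push_cast; ring_nf
  have h₃ : Complex.exp (2 * om * tau * Complex.I) = W ^ 2 := by
    rw [hW, ← Complex.exp_nat_mul]; push_cast; ring_nf
  have h₄ : ∀ j : ℕ, Complex.exp (j * mu * tau) = R ^ j := fun j => by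
    rw [hR, ← Complex.exp_nat_mul]; ring_nf
  have hR₀ : R ≠ 0 := Complex.exp_ne_zero _
  have hW₀ : W ≠ 0 := Complex.exp_ne_zero _
  have hne : 1 - R * W ≠ 0 := by
    rw [← hE]; exact sub_ne_zero.2 (exp_mul_ne_one htau (by simpa using hmu)).symm
  have hne_symm : R * W - 1 ≠ 0 := by
    rw [← neg_sub]; exact neg_ne_zero.2 hne
  have hne' : 1 - R / W ≠ 0 := by
    rw [← hE']; exact sub_ne_zero.2 (exp_mul_ne_one htau (by simpa using hmu)).symm
  have htau' : (tau : ℂ) ≠ 0 := Complex.ofReal_ne_zero.2 htau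
  rw [complexGain₁_add_complexGain₂_mul_I, ofReal_complexGainDenom, placementGain, hE, hE', h₁, h₂,
    h₃, ← Nat.cast_ofNat (n := 3), h₄, ← Nat.cast_ofNat (n := 4), h₄, ← hR, ← hW,
    div_eq_div_iff (by positivity) (by positivity)]
  field_simp
  ring

end Placement

/-! ### Real Jordan forms in complex coordinates -/

/-- The complex number `y (i, 0) + i y (i, 1)` formed by the two coordinates of the `i`-th
two-dimensional block. -/
def pairCoord {m p : ℕ} (y : BlockIndex m p → ℝ) (i : Fin p) : ℂ :=
  y (Sum.inr (i, 0)) + y (Sum.inr (i, 1)) * Complex.I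

/-- Complex coordinates, one for each block. The coordinate of the `i`-th block of either kind is
multiplied by `s ^ i`, which for large `s` makes the superdiagonal couplings small. -/
def scaledCoords {m p : ℕ} (s : ℝ) : (BlockIndex m p → ℝ) →ₗ[ℝ] (Fin m ⊕ Fin p → ℂ) where
  toFun y := Sum.elim (fun i => (s : ℂ) ^ (i : ℕ) * y (Sum.inl i))
    fun i => (s : ℂ) ^ (i : ℕ) * pairCoord y i
  map_add' y y' := by
    funext i
    rcases i with i | i <;> simp [pairCoord] <;> ring
  map_smul' c y := by
    funext i
    rcases i with i | i <;> simp [pairCoord] <;> ring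

/-- The complex numbers represented by the blocks of `blockDiag d fun i => rotBlock (a i) (b i)`. -/
def blockModes {m p : ℕ} (d : Fin m → ℝ) (a b : Fin p → ℝ) : Fin m ⊕ Fin p → ℂ :=
  Sum.elim (fun i => (d i : ℂ)) fun i => a i + b i * Complex.I

/-- The coordinates of a vector in the basis of the Jordan form, labelled by blocks. -/
def jordanCoords {m p n : ℕ} (h : m + p * 2 = n) (V : Matrix (Fin n) (Fin n) ℝ) :
    (Fin n → ℝ) →ₗ[ℝ] (BlockIndex m p → ℝ) :=
  LinearMap.funLeft ℝ ℝ (blockEquiv h) ∘ₗ V.mulVecLin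

section JordanCoordinates

variable {m p n : ℕ}

theorem jordanCoords_injective (h : m + p * 2 = n) {V : Matrix (Fin n) (Fin n) ℝ}
    (hV : IsUnit V) : Function.Injective (jordanCoords h V) :=
  (LinearMap.funLeft_injective_of_surjective ℝ ℝ _ (blockEquiv h).surjective).comp
    (Matrix.mulVec_injective_iff_isUnit.2 hV)

theorem jordanCoords_conj_mulVec (h : m + p * 2 = n) {V : Matrix (Fin n) (Fin n) ℝ}
    (hV : IsUnit V) (D : Matrix (BlockIndex m p) (BlockIndex m p) ℝ) (v : Fin n → ℝ) :
    jordanCoords h V ((V⁻¹ * Matrix.reindex (blockEquiv h) (blockEquiv h) D * V).mulVec v) =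
      D.mulVec (jordanCoords h V v) := by
  have hdet : IsUnit V.det := (Matrix.isUnit_iff_isUnit_det V).1 hV
  have hreindex := Matrix.submatrix_mulVec_equiv D (V.mulVec v) (blockEquiv h).symm
    (blockEquiv h).symm
  funext b
  simp only [jordanCoords, LinearMap.comp_apply, Matrix.mulVecLin_apply, LinearMap.funLeft_apply]
  rw [Matrix.mulVec_mulVec, ← Matrix.mul_assoc, Matrix.mul_nonsing_inv_cancel_left _ _ hdet,
    ← Matrix.mulVec_mulVec, Matrix.reindex_apply, hreindex, Function.comp_apply,
    Equiv.symm_apply_apply, Equiv.symm_symm]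
  rfl

theorem scaledCoords_inl (s : ℝ) (y : BlockIndex m p → ℝ) (i : Fin m) :
    scaledCoords s y (Sum.inl i) = (s : ℂ) ^ (i : ℕ) * y (Sum.inl i) := rfl

theorem scaledCoords_inr (s : ℝ) (y : BlockIndex m p → ℝ) (i : Fin p) :
    scaledCoords s y (Sum.inr i) = (s : ℂ) ^ (i : ℕ) * pairCoord y i := rfl

theorem scaledCoords_injective {s : ℝ} (hs : s ≠ 0) :
    Function.Injective (scaledCoords (m := m) (p := p) s) := by
  refine (injective_iff_map_eq_zero _).2 fun y hy => ?_
  have hpow : ∀ k : ℕ, (s : ℂ) ^ k ≠ 0 := fun k => pow_ne_zero _ (Complex.ofReal_ne_zero.2 hs)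
  have hreal : ∀ i, y (Sum.inl i) = 0 := fun i => by
    simpa [scaledCoords_inl, hpow] using congrFun hy (Sum.inl i)
  have hpair : ∀ i, pairCoord y i = 0 := fun i => by
    simpa [scaledCoords_inr, hpow] using congrFun hy (Sum.inr i)
  funext b
  rcases b with i | ⟨i, a⟩
  · exact hreal i
  · have hre := congrArg Complex.re (hpair i)
    have him := congrArg Complex.im (hpair i)
    simp only [pairCoord, Complex.add_re, Complex.ofReal_re, Complex.mul_re, Complex.I_re,
      Complex.ofReal_im, Complex.I_im, Complex.add_im, Complex.mul_im, Complex.zero_re,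
      Complex.zero_im, mul_zero, mul_one, sub_zero, add_zero, zero_add] at hre him
    fin_cases a
    · exact hre
    · exact him

theorem blockDiag_mulVec_inl (d : Fin m → ℝ) (B : Fin p → Matrix (Fin 2) (Fin 2) ℝ)
    (y : BlockIndex m p → ℝ) (i : Fin m) :
    (blockDiag d B).mulVec y (Sum.inl i) = d i * y (Sum.inl i) := by
  simp [blockDiag, Matrix.mulVec, dotProduct, Fintype.sum_sum_type, Matrix.diagonal_apply]

theorem blockDiag_mulVec_inr (d : Fin m → ℝ) (B : Fin p → Matrix (Fin 2) (Fin 2) ℝ)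
    (y : BlockIndex m p → ℝ) (i : Fin p) (a : Fin 2) :
    (blockDiag d B).mulVec y (Sum.inr (i, a)) =
      B i a 0 * y (Sum.inr (i, 0)) + B i a 1 * y (Sum.inr (i, 1)) := by
  simp [blockDiag, Matrix.mulVec, dotProduct, Fintype.sum_sum_type, Fintype.sum_prod_type,
    Fin.sum_univ_two]

theorem scaledCoords_blockDiag_mulVec (s : ℝ) (d : Fin m → ℝ) (a b : Fin p → ℝ)
    (y : BlockIndex m p → ℝ) :
    scaledCoords s ((blockDiag d fun i => rotBlock (a i) (b i)).mulVec y) =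
      blockModes d a b * scaledCoords s y := by
  funext i
  rcases i with i | i
  · rw [Pi.mul_apply, scaledCoords_inl, scaledCoords_inl, blockDiag_mulVec_inl, blockModes,
      Sum.elim_inl]
    push_cast
    ring
  · simp only [Pi.mul_apply, scaledCoords_inr, pairCoord, blockDiag_mulVec_inr, blockModes,
      Sum.elim_inr, rotBlock, Matrix.of_apply, Matrix.cons_val_zero, Matrix.cons_val_one,
      Matrix.cons_val', Matrix.cons_val_fin_one]
    push_cast
    linear_combination (-(s : ℂ) ^ (i : ℕ) * b i * y (Sum.inr (i, 1))) * Complex.I_mul_I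

theorem sum_eq_zero_or_exists_eq_succ {M : Type*} [AddCommMonoid M] {i : ℕ} {f : Fin m → M}
    (hf : ∀ j, f j ≠ 0 → i + 1 = j) :
    ∑ j, f j = 0 ∨ ∃ j : Fin m, i + 1 = j ∧ ∑ k, f k = f j := by
  by_cases hi : i + 1 < m
  · refine Or.inr ⟨⟨i + 1, hi⟩, rfl, Finset.sum_eq_single _ (fun k _ hk => ?_) (by simp)⟩
    by_contra hne
    exact hk (Fin.ext (hf k hne).symm)
  · refine Or.inl (Finset.sum_eq_zero fun k _ => ?_)
    by_contra hne
    exact hi (hf k hne ▸ k.isLt)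

end JordanCoordinates

namespace IsJordanOffDiag

variable {m p : ℕ} {lam : Fin m → ℝ} {mu om : Fin p → ℝ}
  {N : Matrix (BlockIndex m p) (BlockIndex m p) ℝ}

theorem mulVec_inl (hN : IsJordanOffDiag lam mu om N) (y : BlockIndex m p → ℝ) (i : Fin m) :
    N.mulVec y (Sum.inl i) = 0 ∨
      ∃ j : Fin m, (i : ℕ) + 1 = j ∧ |N.mulVec y (Sum.inl i)| ≤ |y (Sum.inl j)| := by
  have hsum : N.mulVec y (Sum.inl i) = ∑ j, N (Sum.inl i) (Sum.inl j) * y (Sum.inl j) := by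
    simp [Matrix.mulVec, dotProduct, Fintype.sum_sum_type, fun r => (hN.2.1 i r).1]
  have hsucc : ∀ j, N (Sum.inl i) (Sum.inl j) * y (Sum.inl j) ≠ 0 → (i : ℕ) + 1 = j :=
    fun j hj => ((hN.1 i j).resolve_left (left_ne_zero_of_mul hj)).1
  rw [hsum]
  refine (sum_eq_zero_or_exists_eq_succ hsucc).imp_right fun ⟨j, hij, hj⟩ => ⟨j, hij, ?_⟩
  rw [hj]
  rcases hN.1 i j with h | ⟨-, -, h⟩ <;> simp [h]

theorem pairCoord_mulVec (hN : IsJordanOffDiag lam mu om N) (y : BlockIndex m p → ℝ)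
    (i : Fin p) : pairCoord (N.mulVec y) i = 0 ∨
      ∃ j : Fin p, (i : ℕ) + 1 = j ∧ ‖pairCoord (N.mulVec y) i‖ ≤ ‖pairCoord y j‖ := by
  let S : Fin p → Matrix (Fin 2) (Fin 2) ℝ := fun j =>
    Matrix.of fun a b => N (Sum.inr (i, a)) (Sum.inr (j, b))
  let w : Fin p → Fin 2 → ℝ := fun j a =>
    S j a 0 * y (Sum.inr (j, 0)) + S j a 1 * y (Sum.inr (j, 1))
  have hsum : pairCoord (N.mulVec y) i = ∑ j, (w j 0 + w j 1 * Complex.I : ℂ) := by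
    have hrow : ∀ a, N.mulVec y (Sum.inr (i, a)) = ∑ j, w j a := fun a => by
      simp [w, S, Matrix.mulVec, dotProduct, Fintype.sum_sum_type, Fintype.sum_prod_type,
        fun r k => (hN.2.1 k r).2]
    simp only [pairCoord, hrow, Complex.ofReal_sum, Finset.sum_mul, Finset.sum_add_distrib]
  have hsucc : ∀ j, (w j 0 + w j 1 * Complex.I : ℂ) ≠ 0 → (i : ℕ) + 1 = j := fun j hj => by
    refine ((hN.2.2 i j).resolve_left fun h => hj ?_).1
    have hS : S j = 0 := h
    simp [w, hS]
  rw [hsum]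
  refine (sum_eq_zero_or_exists_eq_succ hsucc).imp_right fun ⟨j, hij, hj⟩ => ⟨j, hij, ?_⟩
  rw [hj]
  have hS : S j = 0 ∨ S j = 1 ∨ S j = !![0, 0; 1, 0] :=
    (hN.2.2 i j).imp_right fun h => h.2.2.2
  rcases hS with h | h | h
  · simp [w, h]
  · simp [w, h, pairCoord]
  · have hre := Complex.abs_re_le_norm (pairCoord y j)
    simpa [w, h, pairCoord] using hre

theorem norm_scaledCoords_mulVec_le (hN : IsJordanOffDiag lam mu om N) {s : ℝ} (hs : 0 < s)
    (y : BlockIndex m p → ℝ) : ‖scaledCoords s (N.mulVec y)‖ ≤ s⁻¹ * ‖scaledCoords s y‖ := by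
  refine (pi_norm_le_iff_of_nonneg (by positivity)).2 fun i => ?_
  have hshift : ∀ (k : ℕ) (w w' : ℂ), ‖w‖ ≤ ‖w'‖ →
      ‖(s : ℂ) ^ k * w‖ ≤ s⁻¹ * ‖(s : ℂ) ^ (k + 1) * w'‖ := fun k w w' hw =>
    calc ‖(s : ℂ) ^ k * w‖ ≤ ‖(s : ℂ) ^ k‖ * ‖w'‖ := (norm_mul _ _).trans_le (by gcongr)
      _ = s⁻¹ * ‖(s : ℂ) ^ (k + 1) * w'‖ := by
        rw [pow_succ, norm_mul, norm_mul, Complex.norm_real, Real.norm_of_nonneg hs.le]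
        field_simp
  rcases i with i | i
  · rw [scaledCoords_inl]
    rcases hN.mulVec_inl y i with h | ⟨j, hj, h⟩
    · rw [h, Complex.ofReal_zero, mul_zero, norm_zero]; positivity
    · refine (hshift i _ (y (Sum.inl j)) (by simpa using h)).trans ?_
      rw [hj, ← scaledCoords_inl]
      gcongr
      exact norm_le_pi_norm _ _
  · rw [scaledCoords_inr]
    rcases hN.pairCoord_mulVec y i with h | ⟨j, hj, h⟩
    · rw [h, mul_zero, norm_zero]; positivity
    · refine (hshift i _ _ h).trans ?_
      rw [hj, ← scaledCoords_inr]
      gcongr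
      exact norm_le_pi_norm _ _

end IsJordanOffDiag

/-! ### Eigenvalues of a real Jordan form -/

theorem exists_chain_start {m : ℕ} {α : Type*} {r : Fin m → Fin m → Prop} {f : Fin m → α}
    (hr : ∀ j i, r j i → (j : ℕ) + 1 = i ∧ f j = f i) (i : Fin m) :
    ∃ i₀, f i₀ = f i ∧ ∀ j, ¬ r j i₀ := by
  induction i using WellFoundedLT.induction with
  | ind i ih =>
    by_cases h : ∃ j, r j i
    · obtain ⟨j, hj⟩ := h
      obtain ⟨hsucc, hf⟩ := hr j i hj
      obtain ⟨i₀, hi₀, hstart⟩ := ih j (Fin.lt_def.2 (by omega))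
      exact ⟨i₀, hi₀.trans hf, hstart⟩
    · exact ⟨i, rfl, not_exists.1 h⟩

theorem mem_spectrum_of_mulVec_eq_smul {ι 𝕜 : Type*} [Fintype ι] [DecidableEq ι] [Field 𝕜]
    {M : Matrix ι ι 𝕜} {z : 𝕜} {v : ι → 𝕜} (hv : v ≠ 0) (hMv : M.mulVec v = z • v) :
    z ∈ spectrum 𝕜 M := by
  rw [← Matrix.spectrum_toLin']
  exact (Module.End.hasEigenvalue_of_hasEigenvector
    ⟨Module.End.mem_eigenspace_iff.2 hMv, hv⟩).mem_spectrum

namespace IsRealJordanDecomposition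

variable {m p n : ℕ} {h : m + p * 2 = n} {A V : Matrix (Fin n) (Fin n) ℝ}
  {lam : Fin m → ℝ} {mu om : Fin p → ℝ} {N : Matrix (BlockIndex m p) (BlockIndex m p) ℝ}

theorem spectrum_map (hJ : IsRealJordanDecomposition h A V lam mu om N) :
    spectrum ℂ (A.map (algebraMap ℝ ℂ)) = spectrum ℂ
      ((blockDiag lam (fun i => rotBlock (mu i) (om i)) + N).map (algebraMap ℝ ℂ)) := by
  obtain ⟨⟨V, rfl⟩, -, -, rfl⟩ := hJ
  set D := blockDiag lam (fun i => rotBlock (mu i) (om i)) + N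
  let φ : Matrix (Fin n) (Fin n) ℝ →+* Matrix (Fin n) (Fin n) ℂ := (algebraMap ℝ ℂ).mapMatrix
  have hconj : (((V : Matrix (Fin n) (Fin n) ℝ)⁻¹ *
      Matrix.reindex (blockEquiv h) (blockEquiv h) D * V).map (algebraMap ℝ ℂ)) =
      (Units.map φ.toMonoidHom V)⁻¹.val * Matrix.reindexAlgEquiv ℂ ℂ (blockEquiv h)
        (D.map (algebraMap ℝ ℂ)) * (Units.map φ.toMonoidHom V).val := by
    rw [← Matrix.coe_units_inv]
    exact (map_mul φ _ _).trans (congrArg (· * _) (map_mul φ _ _))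
  rw [hconj, spectrum.units_conjugate', AlgEquiv.spectrum_eq]

theorem ofReal_mem_spectrum (hJ : IsRealJordanDecomposition h A V lam mu om N) (i : Fin m) :
    (lam i : ℂ) ∈ spectrum ℂ (A.map (algebraMap ℝ ℂ)) := by
  have hN := hJ.2.2.1
  obtain ⟨i₀, hi₀, hstart⟩ := exists_chain_start (f := lam)
    (r := fun j i => N (Sum.inl j) (Sum.inl i) ≠ 0)
    (fun j i hj => ((hN.1 j i).resolve_left hj).imp_right And.left) i
  simp only [not_not] at hstart
  rw [hJ.spectrum_map, ← hi₀]
  refine mem_spectrum_of_mulVec_eq_smul (v := Pi.single (Sum.inl i₀) 1) (by simp) ?_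
  rw [Matrix.mulVec_single_one]
  funext b
  rcases b with j | r
  · by_cases hj : j = i₀ <;> simp [hj, hstart, blockDiag]
  · simp [(hN.2.1 i₀ r).2, blockDiag]

theorem add_mul_I_mem_spectrum (hJ : IsRealJordanDecomposition h A V lam mu om N) (i : Fin p) :
    (mu i + om i * Complex.I : ℂ) ∈ spectrum ℂ (A.map (algebraMap ℝ ℂ)) := by
  have hN := hJ.2.2.1
  obtain ⟨i₀, hi₀, hstart⟩ := exists_chain_start (f := fun i => (mu i, om i))
    (r := fun j i => ∃ a b, N (Sum.inr (j, a)) (Sum.inr (i, b)) ≠ 0)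
    (fun j i ⟨a, b, hab⟩ => by
      obtain ⟨hsucc, hmu, hom, -⟩ :=
        (hN.2.2 j i).resolve_left fun h => hab (congrFun (congrFun h a) b)
      exact ⟨hsucc, Prod.ext hmu hom⟩) i
  obtain ⟨hmu, hom⟩ := Prod.mk.inj hi₀
  simp only [not_exists, not_not] at hstart
  rw [hJ.spectrum_map, ← hmu, ← hom]
  -- `(1, -i)` is an eigenvector of `rotBlock a b` with eigenvalue `a + i b`.
  refine mem_spectrum_of_mulVec_eq_smul (v := Pi.single (Sum.inr (i₀, 0)) 1 -
    Complex.I • Pi.single (Sum.inr (i₀, 1)) 1)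
    (fun hv => by simpa using congrFun hv (Sum.inr (i₀, 0))) ?_
  rw [Matrix.mulVec_sub, Matrix.mulVec_smul, Matrix.mulVec_single_one, Matrix.mulVec_single_one]
  funext b
  rcases b with j | ⟨j, a⟩
  · simp [(hN.2.1 j _).1, blockDiag]
  · by_cases hj : j = i₀
    · subst hj
      fin_cases a
      · simp [hstart, blockDiag, rotBlock, mul_comm]
      · have hpair : (om j - Complex.I * mu j : ℂ) = -((mu j + om j * Complex.I) * Complex.I) := by
          linear_combination om j * Complex.I_mul_I
        simpa [hstart, blockDiag, rotBlock] using hpair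
    · simp [hstart, hj, blockDiag]

theorem blockModes_re_ne_zero (hJ : IsRealJordanDecomposition h A V lam mu om N)
    (hA : IsHyperbolic A) (i : Fin m ⊕ Fin p) : (blockModes lam mu om i).re ≠ 0 := by
  rcases i with i | i
  · exact hA _ (hJ.ofReal_mem_spectrum i)
  · exact hA _ (hJ.add_mul_I_mem_spectrum i)

end IsRealJordanDecomposition

/-! ### Stability for a real Jordan decomposition -/

/-- The gains on the blocks: those of positive real part get the multiplier `Z`, the others are
left uncontrolled. -/
def modeGain {ι : Type*} (tau : ℝ) (L Z : ι → ℂ) (i : ι) : ℂ :=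
  if 0 < (L i).re then placementGain tau (L i) (Z i) else 0

theorem norm_modeMultiplier_modeGain_lt_one {ι : Type*} {tau : ℝ} (htau : 0 < tau) {L Z : ι → ℂ}
    {i : ι} (hL : (L i).re ≠ 0) (hZ : ‖Z i‖ < 1) :
    ‖modeMultiplier tau (L i) (modeGain tau L Z i)‖ < 1 := by
  rcases lt_or_gt_of_ne hL with hneg | hpos
  · rw [modeGain, if_neg hneg.not_gt]
    exact norm_modeMultiplier_zero_lt_one htau hneg
  · rwa [modeGain, if_pos hpos, modeMultiplier_placementGain htau hL]

theorem exists_gainTilde_eq_reindex_blockDiag {m p n : ℕ} (h : m + p * 2 = n) {tau : ℝ}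
    (htau : tau ≠ 0) (lam : Fin m → ℝ) (mu om : Fin p → ℝ) (zeta : Fin m → ℝ)
    (rho theta : Fin p → ℝ) :
    ∃ (d : Fin m → ℝ) (a b : Fin p → ℝ),
      gainTilde h tau lam mu om zeta rho theta = Matrix.reindex (blockEquiv h) (blockEquiv h)
        (blockDiag d fun i => rotBlock (a i) (b i)) ∧
      blockModes d a b = modeGain tau (blockModes lam mu om)
        (Sum.elim (fun i => (zeta i : ℂ)) fun i => rho i * Complex.exp (theta i * Complex.I)) := by
  refine ⟨fun i => if 0 < lam i then realGain tau (lam i) (zeta i) else 0,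
    fun i => if 0 < mu i then complexGain₁ tau (mu i) (om i) (rho i) (theta i) else 0,
    fun i => if 0 < mu i then complexGain₂ tau (mu i) (om i) (rho i) (theta i) else 0, ?_, ?_⟩
  · have hzero : rotBlock 0 0 = 0 := by
      ext i j
      fin_cases i <;> fin_cases j <;> simp [rotBlock]
    rw [gainTilde]
    congr 2
    funext i
    by_cases hi : 0 < mu i <;> simp [hi, hzero]
  · funext i
    rcases i with i | i
    · by_cases hi : 0 < lam i <;> simp [blockModes, modeGain, hi, ofReal_realGain]
    · by_cases hi : 0 < mu i
      · simp [blockModes, modeGain, hi, complexGain_eq_placementGain htau hi.ne']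
      · simp [blockModes, modeGain, hi]

namespace IsRealJordanDecomposition

variable {m p n : ℕ} {h : m + p * 2 = n} {A V : Matrix (Fin n) (Fin n) ℝ}
  {lam : Fin m → ℝ} {mu om : Fin p → ℝ} {N : Matrix (BlockIndex m p) (BlockIndex m p) ℝ}

theorem isApproxModeCoordinates (hJ : IsRealJordanDecomposition h A V lam mu om N) {η : ℝ}
    (hη : 0 < η) (d : Fin m → ℝ) (a b : Fin p → ℝ) :
    IsApproxModeCoordinates A
      (V⁻¹ * Matrix.reindex (blockEquiv h) (blockEquiv h)
        (blockDiag d fun i => rotBlock (a i) (b i)) * V)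
      (blockModes lam mu om) (blockModes d a b) η (scaledCoords η⁻¹ ∘ₗ jordanCoords h V) where
  injective := (scaledCoords_injective (inv_ne_zero hη.ne')).comp (jordanCoords_injective h hJ.1)
  map_gain v := by
    rw [LinearMap.comp_apply, jordanCoords_conj_mulVec h hJ.1, scaledCoords_blockDiag_mulVec,
      LinearMap.comp_apply]
  norm_sub_le v := by
    rw [LinearMap.comp_apply, hJ.2.2.2, jordanCoords_conj_mulVec h hJ.1, Matrix.add_mulVec,
      map_add, scaledCoords_blockDiag_mulVec, LinearMap.comp_apply, add_sub_cancel_left]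
    simpa only [inv_inv] using
      hJ.2.2.1.norm_scaledCoords_mulVec_le (inv_pos.2 hη) (jordanCoords h V v)

theorem isLocallyAsymptoticallyStable (hJ : IsRealJordanDecomposition h A V lam mu om N)
    {f : (Fin n → ℝ) → (Fin n → ℝ)} {xs : Fin n → ℝ} {r : ℝ} {Lip : NNReal} (hr : 0 < r)
    (hf : LipschitzOnWith Lip f (Metric.closedBall xs r)) (hA : IsJacobianAt f A xs)
    (hxs : f xs = 0) (hhyp : IsHyperbolic A) {tau : ℝ} (htau : 0 < tau) {zeta : Fin m → ℝ}
    (hzeta : ∀ i, |zeta i| < 1) {rho : Fin p → ℝ} (hrho : ∀ i, |rho i| < 1)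
    (theta : Fin p → ℝ) :
    IsLocallyAsymptoticallyStable f tau (V⁻¹ * gainTilde h tau lam mu om zeta rho theta * V)
      xs := by
  obtain ⟨d, a, b, hgain, hmodes⟩ :=
    exists_gainTilde_eq_reindex_blockDiag h htau.ne' lam mu om zeta rho theta
  rw [hgain]
  refine isLocallyAsymptoticallyStable_of_modes hr hf hA hxs htau (fun i => ?_)
    fun η hη => ⟨_, hJ.isApproxModeCoordinates hη d a b⟩
  rw [hmodes]
  refine norm_modeMultiplier_modeGain_lt_one htau (hJ.blockModes_re_ne_zero hhyp i) ?_
  rcases i with i | i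
  · simpa using hzeta i
  · simpa using hrho i

end IsRealJordanDecomposition

/-! ### Cyclic decomposition of a real endomorphism -/

section CyclicDecomposition

open Polynomial

theorem exists_span_eq_top_of_equiv_directSum {R M ι : Type*} [CommRing R] [AddCommGroup M]
    [Module R M] [Finite ι] {a : ι → R}
    (Ψ : M ≃ₗ[R] DirectSum ι fun i => R ⧸ Submodule.span R {a i}) :
    ∃ g : ι → M, (∀ i, a i • g i = 0) ∧ Submodule.span R (range g) = ⊤ := by
  classical
  cases nonempty_fintype ι
  let one : ∀ i, R ⧸ Submodule.span R {a i} := fun i => Submodule.Quotient.mk 1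
  refine ⟨fun i => Ψ.symm (DirectSum.lof R ι _ i (one i)), fun i => ?_, ?_⟩
  · have hone : a i • one i = 0 := by
      rw [← Submodule.Quotient.mk_smul, Submodule.Quotient.mk_eq_zero, smul_eq_mul, mul_one]
      exact Submodule.mem_span_singleton_self _
    rw [← map_smul, ← map_smul, hone, map_zero, map_zero]
  · refine Submodule.eq_top_iff'.2 fun w => (Submodule.mem_span_range_iff_exists_fun R).2 ?_
    choose c hc using fun i => Submodule.Quotient.mk_surjective _ (Ψ w i)
    have hsmul : ∀ i, c i • one i = Ψ w i := fun i => by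
      rw [← hc i, ← Submodule.Quotient.mk_smul, smul_eq_mul, mul_one]
    refine ⟨c, Ψ.injective ?_⟩
    simp only [map_sum, map_smul, LinearEquiv.apply_symm_apply]
    simp only [← map_smul, hsmul]
    exact DirectSum.sum_univ_of (Ψ w)

theorem exists_cyclic_decomposition.{u, v} {k : Type u} {W : Type v} [Field k] [AddCommGroup W]
    [Module k W] [FiniteDimensional k W] (T : Module.End k W) :
    ∃ (ι : Type u) (_ : Fintype ι) (q : ι → k[X]) (e : ι → ℕ) (g : ι → W),
      (∀ i, Irreducible (q i)) ∧ (∀ i, aeval T (q i ^ e i) (g i) = 0) ∧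
      (∀ w, ∃ c : ι → k[X], w = ∑ i, aeval T (c i) (g i)) ∧
      ∑ i, e i * (q i).natDegree = Module.finrank k W := by
  classical
  obtain ⟨ι, hι, q, hq, e, ⟨Ψ⟩⟩ := Module.equiv_directSum_of_isTorsion
    (Module.AEval.isTorsion_of_finiteDimensional k W T)
  obtain ⟨g, hg, hspan⟩ := exists_span_eq_top_of_equiv_directSum Ψ
  let of := Module.AEval.of k W T
  have hact : ∀ (c : k[X]) i, aeval T c (of.symm (g i)) = of.symm (c • g i) :=
    fun c i => (Module.AEval.of_symm_smul T c (g i)).symm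
  refine ⟨ι, hι, q, e, fun i => of.symm (g i), hq, fun i => ?_, fun w => ?_, ?_⟩
  · rw [hact, hg, map_zero]
  · obtain ⟨c, hc⟩ := (Submodule.mem_span_range_iff_exists_fun k[X]).1
      (hspan ▸ Submodule.mem_top : of w ∈ Submodule.span k[X] (range g))
    refine ⟨c, of.injective ?_⟩
    simp only [hact, map_sum, LinearEquiv.apply_symm_apply, hc]
  · have hfinrank : ∀ i, Module.finrank k (k[X] ⧸ Submodule.span k[X] {q i ^ e i}) =
        e i * (q i).natDegree := fun i =>
      finrank_quotient_span_eq_natDegree.trans (natDegree_pow _ _)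
    have hfinite : ∀ i, Module.Finite k (k[X] ⧸ Submodule.span k[X] {q i ^ e i}) := fun i =>
      (AdjoinRoot.powerBasis (pow_ne_zero _ (hq i).ne_zero)).finite
    rw [(of.trans (Ψ.restrictScalars k)).finrank_eq, Module.finrank_directSum]
    exact Finset.sum_congr rfl fun i _ => (hfinrank i).symm

/-- The real polynomial with roots `a ± i b`. Its leading coefficient `-b⁻¹` is chosen so that,
for the operator of a real Jordan form, it maps the second basis vector of a block to the second
basis vector of the preceding block. -/
def pairPoly (a b : ℝ) : ℝ[X] := C (-b⁻¹) * ((X - C a) ^ 2 + C (b ^ 2))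

theorem natDegree_pairPoly (a : ℝ) {b : ℝ} (hb : b ≠ 0) : (pairPoly a b).natDegree = 2 := by
  rw [pairPoly, natDegree_C_mul (neg_ne_zero.2 (inv_ne_zero hb))]
  compute_degree!

theorem exists_associated_of_irreducible_real {q : ℝ[X]} (hq : Irreducible q) :
    (∃ a : ℝ, Associated (X - C a) q) ∨ ∃ a b : ℝ, b ≠ 0 ∧ Associated (pairPoly a b) q := by
  have hassoc : ∀ s : ℝ[X], s ∣ q → s.natDegree ≠ 0 → Associated s q := fun s hs hdeg =>
    associated_of_dvd_dvd hs
      ((hq.dvd_iff.1 hs).resolve_left fun hu => hdeg (natDegree_eq_zero_of_isUnit hu)).dvd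
  obtain ⟨z, hz⟩ := IsAlgClosed.exists_aeval_eq_zero ℂ q hq.degree_pos.ne'
  by_cases him : z.im = 0
  · refine Or.inl ⟨z.re, hassoc _ ?_ (by rw [natDegree_X_sub_C]; exact one_ne_zero)⟩
    have hre : z = algebraMap ℝ ℂ z.re := Complex.ext rfl him
    rw [hre, aeval_algebraMap_apply] at hz
    exact dvd_iff_isRoot.2 (by simpa using hz)
  · refine Or.inr ⟨z.re, z.im, him, hassoc _ ?_ ?_⟩
    · have hdvd := quadratic_dvd_of_aeval_eq_zero_im_ne_zero q hz him
      have hsq : X ^ 2 - C (2 * z.re) * X + C (‖z‖ ^ 2) = (X - C z.re) ^ 2 + C (z.im ^ 2) := by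
        rw [Complex.sq_norm, Complex.normSq_apply]
        simp only [C_add, C_mul, C_pow, map_ofNat]
        ring
      rw [hsq] at hdvd
      exact (C_mul_dvd (neg_ne_zero.2 (inv_ne_zero him))).2 hdvd
    · rw [natDegree_pairPoly _ him]
      exact two_ne_zero

theorem aeval_pow_apply_eq_zero_of_associated {k W : Type*} [CommRing k] [AddCommGroup W]
    [Module k W] {T : Module.End k W} {q s : k[X]} (h : Associated s q) {e : ℕ} {g : W}
    (hg : aeval T (q ^ e) g = 0) : aeval T (s ^ e) g = 0 := by
  obtain ⟨c, hc⟩ := (h.pow_pow (n := e)).symm.dvd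
  rw [hc, mul_comm, map_mul, Module.End.mul_apply, hg, map_zero]

theorem exists_real_cyclic_decomposition {W : Type*} [AddCommGroup W] [Module ℝ W]
    [FiniteDimensional ℝ W] (T : Module.End ℝ W) :
    ∃ (kr kc : ℕ) (lr : Fin kr → ℝ) (er : Fin kr → ℕ) (gr : Fin kr → W) (mc oc : Fin kc → ℝ)
      (ec : Fin kc → ℕ) (gc : Fin kc → W), (∀ i, oc i ≠ 0) ∧
      (∀ i, aeval T ((X - C (lr i)) ^ er i) (gr i) = 0) ∧
      (∀ i, aeval T (pairPoly (mc i) (oc i) ^ ec i) (gc i) = 0) ∧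
      (∀ w, ∃ (c : Fin kr → ℝ[X]) (d : Fin kc → ℝ[X]),
        w = ∑ i, aeval T (c i) (gr i) + ∑ i, aeval T (d i) (gc i)) ∧
      ∑ i, er i + (∑ i, ec i) * 2 = Module.finrank ℝ W := by
  classical
  obtain ⟨ι, hι, q, e, g, hq, hg, hspan, hdim⟩ := exists_cyclic_decomposition T
  let HasRoot : ι → Prop := fun i => ∃ a : ℝ, Associated (X - C a) (q i)
  choose a ha using fun i : {i // HasRoot i} => i.2
  choose mu om hom hpair using fun i : {i // ¬HasRoot i} =>
    (exists_associated_of_irreducible_real (hq i)).resolve_left i.2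
  have hdeg : ∀ {s t : ℝ[X]}, Associated s t → s.natDegree = t.natDegree := fun h =>
    natDegree_eq_of_degree_eq (degree_eq_degree_of_associated h)
  let φ := (Fintype.equivFin {i // HasRoot i}).symm
  let ψ := (Fintype.equivFin {i // ¬HasRoot i}).symm
  refine ⟨_, _, a ∘ φ, fun i => e (φ i), fun i => g (φ i), mu ∘ ψ, om ∘ ψ, fun i => e (ψ i),
    fun i => g (ψ i), fun i => hom _,
    fun i => aeval_pow_apply_eq_zero_of_associated (ha _) (hg _),
    fun i => aeval_pow_apply_eq_zero_of_associated (hpair _) (hg _), fun w => ?_, ?_⟩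
  · obtain ⟨c, hc⟩ := hspan w
    refine ⟨fun i => c (φ i), fun i => c (ψ i), ?_⟩
    rw [hc, Equiv.sum_comp φ fun i => aeval T (c i) (g i),
      Equiv.sum_comp ψ fun i => aeval T (c i) (g i)]
    exact (Fintype.sum_subtype_add_sum_subtype HasRoot fun i => aeval T (c i) (g i)).symm
  · rw [Equiv.sum_comp φ fun i => e i, Equiv.sum_comp ψ fun i => e i, ← hdim,
      ← Fintype.sum_subtype_add_sum_subtype HasRoot fun i => e i * (q i).natDegree,
      Finset.sum_mul]
    congr 1 <;> refine Finset.sum_congr rfl fun i _ => ?_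
    · rw [← hdeg (ha i), natDegree_X_sub_C, mul_one]
    · rw [← hdeg (hpair i), natDegree_pairPoly _ (hom i)]

end CyclicDecomposition

/-! ### Jordan chains -/

section Chains

open Polynomial

variable {k : ℕ} {s : Fin k → ℕ}

/-- The chain to which an index belongs, for `k` consecutive chains of lengths `s`. -/
def chainOf (x : Fin (∑ i, s i)) : Fin k := (finSigmaFinEquiv.symm x).1

/-- The position of an index in its chain. -/
def chainPos (x : Fin (∑ i, s i)) : ℕ := (finSigmaFinEquiv.symm x).2

theorem chainPos_lt (x : Fin (∑ i, s i)) : chainPos x < s (chainOf x) :=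
  (finSigmaFinEquiv.symm x).2.2

theorem exists_chainOf_eq (i : Fin k) {j : ℕ} (hj : j < s i) :
    ∃ x : Fin (∑ i, s i), chainOf x = i ∧ chainPos x = j :=
  ⟨finSigmaFinEquiv ⟨i, j, hj⟩, by rw [chainOf, Equiv.symm_apply_apply], by
    rw [chainPos, Equiv.symm_apply_apply]⟩

theorem val_add_chainPos_eq {x y : Fin (∑ i, s i)} (h : chainOf x = chainOf y) :
    (x : ℕ) + chainPos y = y + chainPos x := by
  have hval : ∀ x : Fin (∑ i, s i),
      (x : ℕ) = ∑ i : Fin (chainOf x), s (Fin.castLE (chainOf x).2.le i) + chainPos x := fun x => by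
    have := finSigmaFinEquiv_apply (finSigmaFinEquiv.symm x)
    rwa [Equiv.apply_symm_apply] at this
  have hx := hval x
  have hy := hval y
  rw [h] at hx
  omega

/-- The nilpotent matrix that maps every element of a chain to its predecessor and the first one
to zero. -/
def chainShift (K : Type*) [Zero K] [One K] (s : Fin k → ℕ) :
    Matrix (Fin (∑ i, s i)) (Fin (∑ i, s i)) K :=
  Matrix.of fun x y => if (x : ℕ) + 1 = y ∧ chainOf x = chainOf y then 1 else 0

/-- The Jordan chains of the vectors `g i` under `R i`, evaluated at the endomorphism `T`; the last
vector of the `i`-th chain is `g i`. -/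
def chainVec {K W : Type*} [CommRing K] [AddCommGroup W] [Module K W] (T : Module.End K W)
    (s : Fin k → ℕ) (R : Fin k → K[X]) (g : Fin k → W) (x : Fin (∑ i, s i)) : W :=
  aeval T (R (chainOf x) ^ (s (chainOf x) - 1 - chainPos x)) (g (chainOf x))

theorem aeval_chainVec {K W : Type*} [CommRing K] [AddCommGroup W] [Module K W]
    {T : Module.End K W} {R : Fin k → K[X]} {g : Fin k → W}
    (hg : ∀ i, aeval T (R i ^ s i) (g i) = 0) (y : Fin (∑ i, s i)) :
    aeval T (R (chainOf y)) (chainVec T s R g y) =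
      ∑ x, chainShift K s x y • chainVec T s R g x := by
  have hlt := chainPos_lt y
  rw [chainVec, ← Module.End.mul_apply, ← map_mul, ← pow_succ']
  rcases hy : chainPos y with _ | j
  · rw [show s (chainOf y) - 1 - 0 + 1 = s (chainOf y) by omega, hg]
    refine (Finset.sum_eq_zero fun x _ => ?_).symm
    rw [chainShift, Matrix.of_apply, if_neg, zero_smul]
    rintro ⟨hsucc, hchain⟩
    have := val_add_chainPos_eq hchain
    omega
  · obtain ⟨z, hz, hzpos⟩ := exists_chainOf_eq (chainOf y) (show j < s (chainOf y) by omega)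
    have hzy := val_add_chainPos_eq hz
    rw [Finset.sum_eq_single z (fun x _ hx => ?_) (by simp), chainShift, Matrix.of_apply,
      if_pos ⟨by omega, hz⟩, one_smul, chainVec, hz, hzpos,
      show s (chainOf y) - 1 - j = s (chainOf y) - 1 - (j + 1) + 1 by omega]
    rw [chainShift, Matrix.of_apply, if_neg, zero_smul]
    rintro ⟨hsucc, -⟩
    exact hx (Fin.ext (by omega))

theorem aeval_apply_mem_of_forall_pow {K W : Type*} [Field K] [AddCommGroup W] [Module K W]
    {T : Module.End K W} {q : K[X]} (hq : q ≠ 0) {e : ℕ} {g : W} (hg : aeval T (q ^ e) g = 0)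
    {S : Submodule K W}
    (hS : ∀ j < e, ∀ c : K[X], c.degree < q.degree → aeval T (c * q ^ j) g ∈ S) (c : K[X]) :
    aeval T c g ∈ S := by
  suffices h : ∀ d j, j + d = e → ∀ c : K[X], aeval T (c * q ^ j) g ∈ S by
    simpa using h e 0 (zero_add e) c
  intro d
  induction d with
  | zero =>
    rintro j rfl c
    rw [map_mul, Module.End.mul_apply, ← add_zero j, hg, map_zero]
    exact S.zero_mem
  | succ d ih =>
    intro j hj c
    have hdiv : c * q ^ j = c / q * q ^ (j + 1) + c % q * q ^ j := by
      conv_lhs => rw [← EuclideanDomain.div_add_mod c q]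
      ring
    rw [hdiv, map_add, LinearMap.add_apply]
    exact S.add_mem (ih (j + 1) (by omega) _) (hS j (by omega) _ (degree_mod_lt c hq))

theorem aeval_apply_mem_of_chainVec {K W : Type*} [Field K] [AddCommGroup W] [Module K W]
    {T : Module.End K W} {R : Fin k → K[X]} (hR : ∀ i, R i ≠ 0) {g : Fin k → W}
    (hg : ∀ i, aeval T (R i ^ s i) (g i) = 0) {S : Submodule K W}
    (hS : ∀ x, ∀ c : K[X], c.degree < (R (chainOf x)).degree →
      aeval T c (chainVec T s R g x) ∈ S) (i : Fin k) (c : K[X]) : aeval T c (g i) ∈ S := by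
  refine aeval_apply_mem_of_forall_pow (hR i) (hg i) (fun j hj c hc => ?_) c
  obtain ⟨x, rfl, hx⟩ := exists_chainOf_eq i (show s i - 1 - j < s i by omega)
  have hmem := hS x c hc
  rwa [chainVec, hx, ← Module.End.mul_apply, ← map_mul,
    show s (chainOf x) - 1 - (s (chainOf x) - 1 - j) = j by omega] at hmem

end Chains

/-! ### Existence of the real Jordan form -/

section Existence

open Polynomial

theorem exists_conj_of_span_eq_top {ι κ R : Type*} [Fintype ι] [DecidableEq ι] [Fintype κ]
    [CommRing R] (e : κ ≃ ι) {A : Matrix ι ι R} {D : Matrix κ κ R} {b : κ → ι → R}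
    (hspan : Submodule.span R (range b) = ⊤) (hcol : ∀ y, A.mulVec (b y) = ∑ x, D x y • b x) :
    ∃ V, IsUnit V ∧ A = V⁻¹ * Matrix.reindex e e D * V := by
  let P : Matrix ι ι R := (Matrix.of b).transpose.submatrix id e.symm
  have hP : IsUnit P := by
    refine Matrix.mulVec_surjective_iff_isUnit.1 fun v => ?_
    obtain ⟨c, hc⟩ := (Submodule.mem_span_range_iff_exists_fun R).1
      (hspan ▸ Submodule.mem_top : v ∈ Submodule.span R (range b))
    refine ⟨c ∘ e.symm, ?_⟩
    rw [Matrix.submatrix_mulVec_equiv, Equiv.symm_symm, Function.comp_assoc,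
      Equiv.symm_comp_self, Function.comp_id, Matrix.mulVec_transpose,
      Matrix.vecMul_eq_sum, Function.comp_id]
    exact hc
  have hAP : A * P = P * Matrix.reindex e e D := by
    have hmul : A * (Matrix.of b).transpose = (Matrix.of b).transpose * D := by
      ext r y
      simpa [Matrix.mul_apply, Matrix.mulVec, dotProduct, mul_comm] using congrFun (hcol y) r
    rw [Matrix.reindex_apply, Matrix.submatrix_mul_equiv, ← hmul,
      ← Matrix.submatrix_mul_equiv A _ id (Equiv.refl ι)]
    rfl
  have hdet : IsUnit P.det := (Matrix.isUnit_iff_isUnit_det P).1 hP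
  refine ⟨P⁻¹, Matrix.isUnit_nonsing_inv_iff.2 hP, ?_⟩
  rw [Matrix.nonsing_inv_nonsing_inv _ hdet, ← hAP, Matrix.mul_nonsing_inv_cancel_right _ _ hdet]

/-- The basis of the two-dimensional block `rotBlock mu om` whose second vector is `v`. -/
def pairVec {W : Type*} [AddCommGroup W] [Module ℝ W] (T : Module.End ℝ W) (mu om : ℝ) (v : W) :
    Fin 2 → W :=
  ![(-om⁻¹) • (T v - mu • v), v]

theorem pairVec_one {W : Type*} [AddCommGroup W] [Module ℝ W] (T : Module.End ℝ W) (mu om : ℝ)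
    (v : W) : pairVec T mu om v 1 = v := rfl

section PairVec

variable {W : Type*} [AddCommGroup W] [Module ℝ W] (T : Module.End ℝ W) (mu : ℝ) {om : ℝ}

theorem apply_pairVec_zero (hom : om ≠ 0) (v : W) : T (pairVec T mu om v 0) =
    mu • pairVec T mu om v 0 + om • pairVec T mu om v 1 + aeval T (pairPoly mu om) v := by
  simp only [pairVec, pairPoly, pow_two, Matrix.cons_val_zero, Matrix.cons_val_one,
    Matrix.cons_val_fin_one, map_mul, map_add, map_sub, map_smul, aeval_C, aeval_X,
    Module.End.mul_apply, LinearMap.add_apply, LinearMap.sub_apply, Module.algebraMap_end_apply]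
  match_scalars <;> field_simp <;> ring

theorem apply_pairVec_one (hom : om ≠ 0) (v : W) : T (pairVec T mu om v 1) =
    (-om) • pairVec T mu om v 0 + mu • pairVec T mu om v 1 := by
  simp [pairVec, smul_smul, hom]

theorem aeval_mem_span_pairVec (hom : om ≠ 0) (v : W) {c : ℝ[X]} (hc : c.degree < 2) :
    aeval T c v ∈ Submodule.span ℝ (range (pairVec T mu om v)) := by
  obtain ⟨c₁, c₀, rfl⟩ := exists_eq_X_add_C_of_natDegree_le_one
    (natDegree_le_iff_coeff_eq_zero.2 ((degree_lt_iff_coeff_zero c 2).1 hc))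
  have hmem : ∀ a, pairVec T mu om v a ∈ Submodule.span ℝ (range (pairVec T mu om v)) :=
    fun a => Submodule.subset_span (mem_range_self a)
  have hT : T v = (-om) • pairVec T mu om v 0 + mu • v := apply_pairVec_one T mu hom v
  simp only [map_add, map_mul, aeval_C, aeval_X, LinearMap.add_apply, Module.End.mul_apply,
    Module.algebraMap_end_apply]
  rw [hT]
  exact add_mem (Submodule.smul_mem _ _ (add_mem (Submodule.smul_mem _ _ (hmem 0))
    (Submodule.smul_mem _ _ (hmem 1)))) (Submodule.smul_mem _ _ (hmem 1))

end PairVec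

section JordanBasis

variable {kr kc : ℕ} {lr : Fin kr → ℝ} {er : Fin kr → ℕ} {mc oc : Fin kc → ℝ} {ec : Fin kc → ℕ}

/-- The off-diagonal part of the real Jordan matrix with `kr` chains of real blocks of lengths `er`
and `kc` chains of two-dimensional blocks of lengths `ec`. -/
def chainCoupling (er : Fin kr → ℕ) (ec : Fin kc → ℕ) :
    Matrix (BlockIndex (∑ i, er i) (∑ i, ec i)) (BlockIndex (∑ i, er i) (∑ i, ec i)) ℝ :=
  Matrix.fromBlocks (chainShift ℝ er) 0 0
    (Matrix.kroneckerMap (· * ·) (chainShift ℝ ec) !![0, 0; 1, 0])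

theorem isJordanOffDiag_chainCoupling (lr : Fin kr → ℝ) (mc oc : Fin kc → ℝ) :
    IsJordanOffDiag (fun x => lr (chainOf x)) (fun x => mc (chainOf x))
      (fun x => oc (chainOf x)) (chainCoupling er ec) := by
  refine ⟨fun x y => ?_, fun _ _ => ⟨rfl, rfl⟩, fun x y => ?_⟩ <;>
    by_cases hxy : (x : ℕ) + 1 = y ∧ chainOf x = chainOf y
  · exact Or.inr ⟨hxy.1, congrArg lr hxy.2, if_pos hxy⟩
  · exact Or.inl (if_neg hxy)
  · refine Or.inr ⟨hxy.1, congrArg mc hxy.2, congrArg oc hxy.2, Or.inr ?_⟩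
    ext a b
    simp [chainCoupling, chainShift, hxy]
  · refine Or.inl ?_
    ext a b
    simp [chainCoupling, chainShift, hxy]

variable {W : Type*} [AddCommGroup W] [Module ℝ W] {T : Module.End ℝ W} {gr : Fin kr → W}
  {gc : Fin kc → W}

/-- The Jordan basis formed by the chains of the `gr i` under `T - lr i` and by those of the `gc i`
under `pairPoly (mc i) (oc i)`, in which every vector is completed to a pair. -/
def jordanBasis (T : Module.End ℝ W) (lr : Fin kr → ℝ) (er : Fin kr → ℕ) (gr : Fin kr → W)
    (mc oc : Fin kc → ℝ) (ec : Fin kc → ℕ) (gc : Fin kc → W) :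
    BlockIndex (∑ i, er i) (∑ i, ec i) → W :=
  Sum.elim (chainVec T er (fun i => X - C (lr i)) gr) fun r =>
    pairVec T (mc (chainOf r.1)) (oc (chainOf r.1))
      (chainVec T ec (fun i => pairPoly (mc i) (oc i)) gc r.1) r.2

theorem apply_jordanBasis (hoc : ∀ i, oc i ≠ 0)
    (hgr : ∀ i, aeval T ((X - C (lr i)) ^ er i) (gr i) = 0)
    (hgc : ∀ i, aeval T (pairPoly (mc i) (oc i) ^ ec i) (gc i) = 0)
    (y : BlockIndex (∑ i, er i) (∑ i, ec i)) :
    T (jordanBasis T lr er gr mc oc ec gc y) =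
      ∑ x, (blockDiag (fun x => lr (chainOf x))
          (fun x => rotBlock (mc (chainOf x)) (oc (chainOf x))) + chainCoupling er ec :
            Matrix (BlockIndex (∑ i, er i) (∑ i, ec i)) _ ℝ) x y •
        jordanBasis T lr er gr mc oc ec gc x := by
  rcases y with y | ⟨y, a⟩
  · have hchain := aeval_chainVec hgr y
    rw [map_sub, aeval_X, aeval_C, LinearMap.sub_apply, Module.algebraMap_end_apply,
      sub_eq_iff_eq_add'] at hchain
    simpa [jordanBasis, blockDiag, chainCoupling, add_smul, Finset.sum_add_distrib,
      Matrix.diagonal_apply] using hchain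
  · have hchain := aeval_chainVec hgc y
    fin_cases a
    · have hpair := apply_pairVec_zero T (mc (chainOf y)) (hoc (chainOf y))
        (chainVec T ec (fun i => pairPoly (mc i) (oc i)) gc y)
      rw [hchain] at hpair
      simpa [jordanBasis, blockDiag, chainCoupling, rotBlock, add_smul, Finset.sum_add_distrib,
        Fintype.sum_prod_type, pairVec_one] using hpair
    · simpa [jordanBasis, blockDiag, chainCoupling, rotBlock, add_smul, Finset.sum_add_distrib,
        Fintype.sum_prod_type] using apply_pairVec_one T (mc (chainOf y)) (hoc (chainOf y))
          (chainVec T ec (fun i => pairPoly (mc i) (oc i)) gc y)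

theorem span_jordanBasis (hoc : ∀ i, oc i ≠ 0)
    (hgr : ∀ i, aeval T ((X - C (lr i)) ^ er i) (gr i) = 0)
    (hgc : ∀ i, aeval T (pairPoly (mc i) (oc i) ^ ec i) (gc i) = 0)
    (hspan : ∀ w, ∃ (c : Fin kr → ℝ[X]) (d : Fin kc → ℝ[X]),
      w = ∑ i, aeval T (c i) (gr i) + ∑ i, aeval T (d i) (gc i)) :
    Submodule.span ℝ (range (jordanBasis T lr er gr mc oc ec gc)) = ⊤ := by
  set S := Submodule.span ℝ (range (jordanBasis T lr er gr mc oc ec gc))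
  have hmem : ∀ x, jordanBasis T lr er gr mc oc ec gc x ∈ S := fun x =>
    Submodule.subset_span (mem_range_self x)
  have hreal : ∀ i (c : ℝ[X]), aeval T c (gr i) ∈ S := by
    refine aeval_apply_mem_of_chainVec (fun i => X_sub_C_ne_zero _) hgr fun x c hc => ?_
    rw [degree_X_sub_C] at hc
    rw [eq_C_of_degree_le_zero (Nat.WithBot.lt_one_iff_le_zero.1 hc), aeval_C,
      Module.algebraMap_end_apply]
    exact S.smul_mem _ (hmem (Sum.inl x))
  have hpair : ∀ i (c : ℝ[X]), aeval T c (gc i) ∈ S := by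
    have hdeg : ∀ i, (pairPoly (mc i) (oc i)).natDegree = 2 := fun i =>
      natDegree_pairPoly _ (hoc i)
    have hne : ∀ i, pairPoly (mc i) (oc i) ≠ 0 := fun i =>
      ne_zero_of_natDegree_gt (n := 0) (by rw [hdeg]; exact two_pos)
    refine aeval_apply_mem_of_chainVec hne hgc fun x c hc => ?_
    rw [degree_eq_natDegree (hne _), hdeg] at hc
    refine Submodule.span_le.2 ?_ (aeval_mem_span_pairVec T (mc (chainOf x)) (hoc (chainOf x)) _ hc)
    rintro _ ⟨a, rfl⟩
    exact hmem (Sum.inr (x, a))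
  refine Submodule.eq_top_iff'.2 fun w => ?_
  obtain ⟨c, d, rfl⟩ := hspan w
  exact S.add_mem (S.sum_mem fun i _ => hreal i _) (S.sum_mem fun i _ => hpair i _)

end JordanBasis

theorem exists_isRealJordanDecomposition {n : ℕ} (A : Matrix (Fin n) (Fin n) ℝ) :
    ∃ (m p : ℕ) (h : m + p * 2 = n) (V : Matrix (Fin n) (Fin n) ℝ)
      (lam : Fin m → ℝ) (mu om : Fin p → ℝ) (N : Matrix (BlockIndex m p) (BlockIndex m p) ℝ),
      IsRealJordanDecomposition h A V lam mu om N := by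
  obtain ⟨kr, kc, lr, er, gr, mc, oc, ec, gc, hoc, hgr, hgc, hspan, hdim⟩ :=
    exists_real_cyclic_decomposition A.mulVecLin
  rw [Module.finrank_fin_fun] at hdim
  obtain ⟨V, hV, hA⟩ := exists_conj_of_span_eq_top (blockEquiv hdim)
    (span_jordanBasis hoc hgr hgc hspan) (apply_jordanBasis hoc hgr hgc)
  exact ⟨_, _, hdim, V, _, _, _, _, hV, fun x => hoc _, isJordanOffDiag_chainCoupling lr mc oc, hA⟩

end Existence

end TDFC

end

theorem mainTheorem1_general (n : ℕ) (f : (Fin n → ℝ) → (Fin n → ℝ)) (xs : Fin n → ℝ)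
    (A : Matrix (Fin n) (Fin n) ℝ)
    (hf : ∃ r > 0, ∃ Lip, LipschitzOnWith Lip f (Metric.closedBall xs r))
    (hA : TDFC.IsJacobianAt f A xs) (hxs : f xs = 0) (hhyp : TDFC.IsHyperbolic A) :
    (∃ (m p : ℕ) (h : m + p * 2 = n) (V : Matrix (Fin n) (Fin n) ℝ)
      (lam : Fin m → ℝ) (mu om : Fin p → ℝ)
      (N : Matrix (TDFC.BlockIndex m p) (TDFC.BlockIndex m p) ℝ),
      TDFC.IsRealJordanDecomposition h A V lam mu om N) ∧
    ∀ (m p : ℕ) (h : m + p * 2 = n) (V : Matrix (Fin n) (Fin n) ℝ)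
      (lam : Fin m → ℝ) (mu om : Fin p → ℝ)
      (N : Matrix (TDFC.BlockIndex m p) (TDFC.BlockIndex m p) ℝ),
      TDFC.IsRealJordanDecomposition h A V lam mu om N →
      ∀ (tau : ℝ), 0 < tau →
      ∀ (zeta : Fin m → ℝ), (∀ i, |zeta i| < 1) →
      ∀ (rho theta : Fin p → ℝ), (∀ i, |rho i| < 1) →
      TDFC.IsLocallyAsymptoticallyStable f tau
        (V⁻¹ * TDFC.gainTilde h tau lam mu om zeta rho theta * V) xs := by
  obtain ⟨r, hr, Lip, hLip⟩ := hf
  refine ⟨TDFC.exists_isRealJordanDecomposition A, ?_⟩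
  intro m p h V lam mu om N hJ tau htau zeta hzeta rho theta hrho
  exact hJ.isLocallyAsymptoticallyStable hr hLip hA hxs hhyp htau hzeta hrho theta

theorem mainTheorem1 (n : ℕ) (f : (Fin n → ℝ) → (Fin n → ℝ)) (xs : Fin n → ℝ)
    (A : Matrix (Fin n) (Fin n) ℝ)
    (hf : TDFC.PiecewiseC1At f xs) (hA : TDFC.IsJacobianAt f A xs)
    (hxs : f xs = 0) (hhyp : TDFC.IsHyperbolic A) :
    (∃ (m p : ℕ) (h : m + p * 2 = n) (V : Matrix (Fin n) (Fin n) ℝ)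
      (lam : Fin m → ℝ) (mu om : Fin p → ℝ)
      (N : Matrix (TDFC.BlockIndex m p) (TDFC.BlockIndex m p) ℝ),
      TDFC.IsRealJordanDecomposition h A V lam mu om N) ∧
    ∀ (m p : ℕ) (h : m + p * 2 = n) (V : Matrix (Fin n) (Fin n) ℝ)
      (lam : Fin m → ℝ) (mu om : Fin p → ℝ)
      (N : Matrix (TDFC.BlockIndex m p) (TDFC.BlockIndex m p) ℝ),
      TDFC.IsRealJordanDecomposition h A V lam mu om N →
      ∀ (tau : ℝ), 0 < tau →
      ∀ (zeta : Fin m → ℝ), (∀ i, |zeta i| < 1) →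
      ∀ (rho theta : Fin p → ℝ), (∀ i, 0 ≤ rho i ∧ rho i < 1) →
        (∀ i, 0 ≤ theta i ∧ theta i < 2 * Real.pi) →
      TDFC.IsLocallyAsymptoticallyStable f tau
        (V⁻¹ * TDFC.gainTilde h tau lam mu om zeta rho theta * V) xs := by
  have h := mainTheorem1_general n f xs A hf.exists_lipschitzOnWith hA hxs hhyp
  exact ⟨h.1, fun m p hmp V lam mu om N hJ tau htau zeta hzeta rho theta hrho _ =>
    h.2 m p hmp V lam mu om N hJ tau htau zeta hzeta rho theta fun i =>
      abs_lt.2 ⟨by linarith [(hrho i).1], (hrho i).2⟩⟩
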